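/- Let $N$ be a smooth manifold (Hausdorff, second countable, without boundary, not necessarily compact or connected) of dimension $n \ge 1$. Let $\pi \colon T^*N \to N$ be its cotangent bundle, let $\theta$ be the tautological $1$-form on $T^*N$, given by $\theta_\xi(w) = \xi(d\pi_\xi(w))$ for $\xi \in T^*N$ and $w \in T_\xi(T^*N)$, and let $\omega_{\mathrm{can}} = -d\theta$ be the canonical symplectic form. Then there is a smooth $1$-form $\alpha$ on $T^*N$ which vanishes at no point and satisfies $d\alpha = \omega_{\mathrm{can}}$. Equivalently, $T^*N$ admits a nowhere-vanishing Liouville vector field, that is, a smooth vector field $X$ on $T^*N$ which vanishes at no point and satisfies $\mathcal{L}_X \omega_{\mathrm{can}} = \omega_{\mathrm{can}}$. -/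

import Mathlib

open scoped Manifold ContDiff Bundle

noncomputable section

section Forms

variable {E : Type*} [NormedAddCommGroup E] [NormedSpace ℝ E]
  {H : Type*} [TopologicalSpace H] (I : ModelWithCorners ℝ E H)
  {M : Type*} [TopologicalSpace M] [ChartedSpace H M]

variable (M) in
/-- A (not necessarily smooth) differential `k`-form on the manifold `M`: an alternating `k`-linear
form on every tangent space. -/
abbrev FormField (k : ℕ) : Type _ :=
  ∀ p : M, TangentSpace I p [⋀^Fin k]→L[ℝ] ℝ

variable {I} {k : ℕ}

/-- The expression of the form `η` in the preferred chart `φ` around `p`, that is, the pullback of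
`η` under `φ⁻¹`. It is meaningful on the target of `φ`. -/
def FormField.inChart (η : FormField I M k) (p : M) (y : E) : E [⋀^Fin k]→L[ℝ] ℝ :=
  (η ((extChartAt I p).symm y)).compContinuousLinearMap
    (mfderivWithin 𝓘(ℝ, E) I (extChartAt I p).symm (Set.range I) y)

/-- A form is smooth if its expressions in charts are. -/
def FormField.IsSmooth (η : FormField I M k) : Prop :=
  ∀ p : M, ContDiffOn ℝ ∞ (η.inChart p) (extChartAt I p).target

/-- The exterior derivative of a form. At `p` it is computed in the preferred chart `φ` around `p`,
as the pullback under `φ` of the exterior derivative of the expression of `η` in `φ`. -/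
def FormField.d (η : FormField I M k) : FormField I M (k + 1) := fun p =>
  (extDerivWithin (η.inChart p) (Set.range I) (extChartAt I p p)).compContinuousLinearMap
    (mfderiv I 𝓘(ℝ, E) (extChartAt I p) p)

/-- A form is nowhere vanishing if its value at every point is a nonzero alternating form. -/
def FormField.NowhereVanishing (η : FormField I M k) : Prop :=
  ∀ p : M, η p ≠ 0

/-- The Lie derivative `L_X η` of a form along a vector field, evaluated on tangent vectors
`v₁, …, v_k` at `p`. In the preferred chart around `p` it is given by the usual formula
`(L_X η)(v₁, …, v_k) = (D_X η)(v₁, …, v_k) + ∑ i, η (v₁, …, D_{v_i} X, …, v_k)`. -/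
def FormField.lieDeriv (X : ∀ p : M, TangentSpace I p) (η : FormField I M k) (p : M)
    (v : Fin k → TangentSpace I p) : ℝ :=
  let x : E := extChartAt I p p
  let X' : E → E :=
    VectorField.mpullbackWithin 𝓘(ℝ, E) I (extChartAt I p).symm X (Set.range I)
  let v' : Fin k → E := fun i => mfderiv I 𝓘(ℝ, E) (extChartAt I p) p (v i)
  fderivWithin ℝ (η.inChart p) (Set.range I) x (X' x) v' +
    ∑ i, η.inChart p x (Function.update v' i (fderivWithin ℝ X' (Set.range I) x (v' i)))

/-- The smooth vector field `X` is a Liouville vector field for the 2-form `η` if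
`L_X η = η`. -/
structure IsLiouvilleField [IsManifold I 1 M] (η : FormField I M 2) (X : ∀ p : M, TangentSpace I p) :
    Prop where
  smooth : ContMDiff I I.tangent ∞ (fun p => (⟨p, X p⟩ : TangentBundle I M))
  lieDeriv_eq : ∀ (p : M) (v : Fin 2 → TangentSpace I p), FormField.lieDeriv X η p v = η p v

end Forms

section Cotangent

variable {E : Type*} [NormedAddCommGroup E] [NormedSpace ℝ E]
  {H : Type*} [TopologicalSpace H] (I : ModelWithCorners ℝ E H)
  (N : Type*) [TopologicalSpace N] [ChartedSpace H N]

/-- The cotangent bundle `T*N`, with Mathlib's topology and smooth structure on the bundle of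
continuous linear maps from the tangent bundle to the trivial line bundle. -/
abbrev CotangentBundle : Type _ :=
  Bundle.TotalSpace (E →L[ℝ] ℝ) (fun x : N => TangentSpace I x →L[ℝ] ℝ)

variable [IsManifold I ∞ N]

/-- The tautological 1-form `θ` on `T*N`: `θ_ξ(w) = ξ(dπ(w))` for `ξ ∈ T*N` and `w ∈ T_ξ(T*N)`,
where `π : T*N → N` is the projection. -/
def tautologicalForm : FormField (I.prod 𝓘(ℝ, E →L[ℝ] ℝ)) (CotangentBundle I N) 1 := fun ξ =>
  ContinuousAlternatingMap.ofSubsingleton ℝ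
    (TangentSpace (I.prod 𝓘(ℝ, E →L[ℝ] ℝ)) ξ) ℝ (0 : Fin 1)
    (ξ.snd.comp (mfderiv (I.prod 𝓘(ℝ, E →L[ℝ] ℝ)) I
      (Bundle.TotalSpace.proj : CotangentBundle I N → N) ξ))

/-- The canonical symplectic form `ω_can = -dθ` on `T*N`; in canonical coordinates
`(x_i, ξ_i)` it is `∑ i, dx_i ∧ dξ_i`. -/
def canonicalForm : FormField (I.prod 𝓘(ℝ, E →L[ℝ] ℝ)) (CotangentBundle I N) 2 := fun ξ =>
  -(tautologicalForm I N).d ξ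

end Cotangent

end

/-! If `f` is a smooth function on `T*N`, then `α = df - θ` satisfies `dα = -dθ = ω_can`, and `α`
vanishes exactly where `df = θ`. So it suffices to find `f` for which these coincidences do not
occur (`exists_forall_not_derivEqTaut`). The Liouville field is then given by `ι_X ω_can = α`: it
vanishes only where `α` does, and `L_X ω_can = d ι_X ω_can = ω_can`.

The construction starts from `f = 0`, whose coincidence set is the zero section, and treats the
balls of a countable locally finite cover one at a time (`IsAdmissible.exists_step`). It keeps the
coincidence set proper over `N` and never creates coincidences over balls already treated.

For one ball there are two moves. First, the part of the base-point space lying over a sphere is a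
null set, and `y ↦ dg - θ` maps between spaces of equal dimension. Its values over the sphere
therefore miss arbitrarily small linear forms `ℓ`, and subtracting a cut-off multiple of such an `ℓ`
clears the sphere (`exists_perturbation`). Second, the coincidences left over the ball form a
compact set away from the sphere, and they are swept to infinity along the fibres
(`exists_removal`).

The sweep uses compactly supported symplectic maps `R` with `R*θ - θ = dP`
(`fderiv_ellipticTwistPrimitive`). Replacing `g` by `g ∘ R - P` turns `dg - θ` into `R*(dg - θ)`, so
the coincidence set is replaced by its preimage under `R`. Each `R` is a half turn on a large
ellipsoid, and it shifts the set by a fixed unit covector. The supports leave every bounded set of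
covectors, so the infinite composition is locally finite and its limit has no coincidences over the
ball. -/

noncomputable section

/-! ### Symplectic twists of the flat model -/

section LocalModel

open Filter Topology Set
open scoped RealInnerProductSpace

variable {E : Type*} [NormedAddCommGroup E] [InnerProductSpace ℝ E]

/-- The tautological form in canonical coordinates, with covectors written as vectors:
`(x, η) ↦ ((v, w) ↦ ⟪η, v⟫)`. -/
def modelTaut : E × E →L[ℝ] (E × E →L[ℝ] ℝ) :=
  ((ContinuousLinearMap.compL ℝ (E × E) E ℝ).flip (ContinuousLinearMap.fst ℝ E E)).comp
    ((innerSL ℝ).comp (ContinuousLinearMap.snd ℝ E E))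

@[simp]
theorem modelTaut_apply (y h : E × E) : modelTaut y h = ⟪y.2, h.1⟫ := rfl

/-- The squared distance to `z` in the norm `‖x‖ ^ 2 + ‖η‖ ^ 2 / μ ^ 2`. -/
def ellipticSq (z : E × E) (μ : ℝ) (y : E × E) : ℝ :=
  ‖y.1 - z.1‖ ^ 2 + ‖y.2 - z.2‖ ^ 2 / μ ^ 2

/-- The symplectic twist about `z`, the time-one map of the Hamiltonian flow of a function of
`ellipticSq z μ`. It rotates each ellipsoid of level `s` by the angle `deriv T s`. -/
def ellipticTwist (T : ℝ → ℝ) (z : E × E) (μ : ℝ) (y : E × E) : E × E :=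
  let τ := deriv T (ellipticSq z μ y)
  (z.1 + Real.cos τ • (y.1 - z.1) + (Real.sin τ / μ) • (y.2 - z.2),
    z.2 - (μ * Real.sin τ) • (y.1 - z.1) + Real.cos τ • (y.2 - z.2))

/-- A primitive of the difference between the pullback of the tautological form under
`ellipticTwist T z μ` and the tautological form. -/
def ellipticTwistPrimitive (T : ℝ → ℝ) (z : E × E) (μ : ℝ) (y : E × E) : ℝ :=
  let y' := ellipticTwist T z μ y
  let s := ellipticSq z μ y
  ⟪z.2, y'.1 - y.1⟫ + (⟪y'.2 - z.2, y'.1 - z.1⟫ - ⟪y.2 - z.2, y.1 - z.1⟫) / 2 +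
    μ * (s * deriv T s - T s) / 2

theorem contDiff_ellipticSq (z : E × E) (μ : ℝ) : ContDiff ℝ ∞ (ellipticSq z μ) := by
  unfold ellipticSq
  exact ((contDiff_fst.sub contDiff_const).norm_sq ℝ).add
    (((contDiff_snd.sub contDiff_const).norm_sq ℝ).div_const _)

theorem ContDiff.deriv_infty {T : ℝ → ℝ} (hT : ContDiff ℝ ∞ T) : ContDiff ℝ ∞ (deriv T) :=
  (contDiff_infty_iff_deriv.1 hT).2

theorem contDiff_ellipticTwist {T : ℝ → ℝ} (hT : ContDiff ℝ ∞ T) (z : E × E) (μ : ℝ) :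
    ContDiff ℝ ∞ (ellipticTwist T z μ) := by
  have hτ : ContDiff ℝ ∞ fun y => deriv T (ellipticSq z μ y) :=
    hT.deriv_infty.comp (contDiff_ellipticSq z μ)
  have h1 : ContDiff ℝ ∞ fun y : E × E => y.1 - z.1 := contDiff_fst.sub contDiff_const
  have h2 : ContDiff ℝ ∞ fun y : E × E => y.2 - z.2 := contDiff_snd.sub contDiff_const
  have hc := Real.contDiff_cos.comp hτ
  have hs := Real.contDiff_sin.comp hτ
  exact ((contDiff_const.add (hc.smul h1)).add ((hs.div_const μ).smul h2)).prodMk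
    ((contDiff_const.sub ((contDiff_const.mul hs).smul h1)).add (hc.smul h2))

theorem contDiff_ellipticTwistPrimitive {T : ℝ → ℝ} (hT : ContDiff ℝ ∞ T) (z : E × E) (μ : ℝ) :
    ContDiff ℝ ∞ (ellipticTwistPrimitive T z μ) := by
  have hs := contDiff_ellipticSq z μ
  have h := contDiff_ellipticTwist hT z μ
  have h1 := contDiff_fst.comp h
  have h2 := contDiff_snd.comp h
  have i1 : ContDiff ℝ ∞ fun y : E × E => y.1 := contDiff_fst
  have i2 : ContDiff ℝ ∞ fun y : E × E => y.2 := contDiff_snd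
  exact ((contDiff_const.inner ℝ (h1.sub i1)).add
    ((((h2.sub contDiff_const).inner ℝ (h1.sub contDiff_const)).sub
      ((i2.sub contDiff_const).inner ℝ (i1.sub contDiff_const))).div_const 2)).add
    ((contDiff_const.mul ((hs.mul (hT.deriv_infty.comp hs)).sub (hT.comp hs))).div_const 2)

/-- In the coordinates `(x, η / μ)` centred at `z` the twist is an orthogonal rotation. Since the
level is kept, so is the angle, and the twist by `-T` is the inverse. -/
theorem ellipticSq_ellipticTwist (T : ℝ → ℝ) (z : E × E) {μ : ℝ} (hμ : 0 < μ) (y : E × E) :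
    ellipticSq z μ (ellipticTwist T z μ y) = ellipticSq z μ y := by
  simp only [ellipticTwist]
  set τ := deriv T (ellipticSq z μ y)
  have h := Real.sin_sq_add_cos_sq τ
  simp only [ellipticSq]
  have e1 : z.1 + Real.cos τ • (y.1 - z.1) + (Real.sin τ / μ) • (y.2 - z.2) - z.1 =
    Real.cos τ • (y.1 - z.1) + (Real.sin τ / μ) • (y.2 - z.2) := by abel
  have e2 : z.2 - (μ * Real.sin τ) • (y.1 - z.1) + Real.cos τ • (y.2 - z.2) - z.2 =
    Real.cos τ • (y.2 - z.2) - (μ * Real.sin τ) • (y.1 - z.1) := by abel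
  rw [e1, e2, norm_add_sq_real, norm_sub_sq_real]
  simp only [norm_smul, inner_smul_left, inner_smul_right, mul_pow, Real.norm_eq_abs, sq_abs,
    real_inner_comm (y.1 - z.1) (y.2 - z.2)]
  generalize ‖y.1 - z.1‖ = a
  generalize ‖y.2 - z.2‖ = b
  simp only [RCLike.conj_to_real]
  field_simp
  linear_combination (b ^ 2 + a ^ 2 * μ ^ 2) * h

theorem ellipticTwist_neg_ellipticTwist (T : ℝ → ℝ) (z : E × E) {μ : ℝ} (hμ : 0 < μ) (y : E × E) :
    ellipticTwist (-T) z μ (ellipticTwist T z μ y) = y := by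
  have h1 := ellipticSq_ellipticTwist T z hμ y
  have h := Real.sin_sq_add_cos_sq (deriv T (ellipticSq z μ y))
  obtain ⟨w, hw⟩ : ∃ w, w = ellipticTwist T z μ y := ⟨_, rfl⟩
  rw [← hw] at h1 ⊢
  simp only [ellipticTwist, h1, deriv.neg, Real.cos_neg, Real.sin_neg]
  rw [hw]
  simp only [ellipticTwist]
  set C := Real.cos (deriv T (ellipticSq z μ y))
  set S := Real.sin (deriv T (ellipticSq z μ y))
  ext1
  · simp only
    match_scalars <;> field_simp <;>
      first | linear_combination h | linear_combination -h | ring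
  · simp only
    match_scalars <;> field_simp <;>
      first | linear_combination h | linear_combination -h | ring

theorem surjective_fderiv_ellipticTwist {T : ℝ → ℝ} (hT : ContDiff ℝ ∞ T) (z : E × E) {μ : ℝ}
    (hμ : 0 < μ) (y : E × E) : Function.Surjective (fderiv ℝ (ellipticTwist T z μ) y) := by
  have hd : ∀ {T : ℝ → ℝ}, ContDiff ℝ ∞ T → Differentiable ℝ (ellipticTwist T z μ) := fun hT =>
    (contDiff_ellipticTwist hT z μ).differentiable (by simp)
  have hid : ellipticTwist T z μ ∘ ellipticTwist (-T) z μ = id := by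
    funext w
    simpa using ellipticTwist_neg_ellipticTwist (-T) z hμ w
  have h2 := ellipticTwist_neg_ellipticTwist T z hμ y
  intro v
  refine ⟨fderiv ℝ (ellipticTwist (-T) z μ) (ellipticTwist T z μ y) v, ?_⟩
  have h3 := fderiv_comp (𝕜 := ℝ) (ellipticTwist T z μ y) (hd hT _) (hd hT.neg _)
  change fderiv ℝ (ellipticTwist T z μ ∘ ellipticTwist (-T) z μ) _ =
    (fderiv ℝ (ellipticTwist T z μ) (ellipticTwist (-T) z μ _)).comp
      (fderiv ℝ (ellipticTwist (-T) z μ) _) at h3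
  rw [hid, fderiv_id, h2] at h3
  exact (congrArg (fun L => L v) h3).symm

/-- Take `z = 0`. Subtracting `d⟪η, x⟫ / 2` from `θ` leaves `(η dx - x dη) / 2`, which rotations of
fixed angle preserve. The variation of the angle `τ = T' s` adds `μ s dτ / 2 = d (μ (s T' - T) /
2)`. A centre `z` contributes the term in `⟪z.2, ·⟫`. The proof checks this along the line `y + t
h`. -/
theorem fderiv_ellipticTwistPrimitive {T : ℝ → ℝ} (hT : ContDiff ℝ ∞ T) (z : E × E) {μ : ℝ}
    (hμ : 0 < μ) (y h : E × E) :
    fderiv ℝ (ellipticTwistPrimitive T z μ) y h =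
      ⟪(ellipticTwist T z μ y).2, (fderiv ℝ (ellipticTwist T z μ) y h).1⟫ - ⟪y.2, h.1⟫ := by
  let γ : ℝ → E × E := fun t => y + t • h
  have hγ : HasDerivAt γ h 0 := by
    have := ((hasDerivAt_id (0 : ℝ)).smul_const h).const_add y
    rwa [one_smul] at this
  have hγ0 : γ 0 = y := by simp [γ]
  have hs0 : HasDerivAt (fun t => ellipticSq z μ (γ t)) (fderiv ℝ (ellipticSq z μ) y h) 0 := by
    have := ((contDiff_ellipticSq z μ).differentiable (by simp) (γ 0)).hasFDerivAt.comp_hasDerivAt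
      0 hγ
    rwa [hγ0] at this
  obtain ⟨s', hs'⟩ : ∃ s', s' = fderiv ℝ (ellipticSq z μ) y h := ⟨_, rfl⟩
  rw [← hs'] at hs0
  have hu : HasDerivAt (fun t => (γ t).1 - z.1) h.1 0 := hγ.fst.sub_const _
  have hw : HasDerivAt (fun t => (γ t).2 - z.2) h.2 0 := hγ.snd.sub_const _
  have hTs : HasDerivAt (fun t => T (ellipticSq z μ (γ t)))
      (deriv T (ellipticSq z μ y) * s') 0 := by
    have h1 : HasDerivAt T (deriv T (ellipticSq z μ (γ 0))) (ellipticSq z μ (γ 0)) :=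
      (hT.differentiable (by simp) _).hasDerivAt
    have := h1.comp 0 hs0
    rwa [hγ0] at this
  obtain ⟨τ', hτ'⟩ : ∃ τ', τ' = deriv (deriv T) (ellipticSq z μ y) * s' := ⟨_, rfl⟩
  have hτ : HasDerivAt (fun t => deriv T (ellipticSq z μ (γ t))) τ' 0 := by
    have h1 : HasDerivAt (deriv T) (deriv (deriv T) (ellipticSq z μ (γ 0)))
      (ellipticSq z μ (γ 0)) := (hT.deriv_infty.differentiable (by simp) _).hasDerivAt
    have := h1.comp 0 hs0
    rwa [hγ0, ← hτ'] at this
  have hX := (((hτ.cos.smul hu).const_add z.1).add ((hτ.sin.div_const μ).smul hw))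
  have hY := ((((hτ.sin.const_mul μ).smul hu).const_sub z.2).add (hτ.cos.smul hw))
  have hR : HasDerivAt (fun t => ellipticTwist T z μ (γ t))
      (fderiv ℝ (ellipticTwist T z μ) y h) 0 := by
    have := ((contDiff_ellipticTwist hT z μ).differentiable (by simp)
      (γ 0)).hasFDerivAt.comp_hasDerivAt 0 hγ
    rwa [hγ0] at this
  have hP : HasDerivAt (fun t => ellipticTwistPrimitive T z μ (γ t))
      (fderiv ℝ (ellipticTwistPrimitive T z μ) y h) 0 := by
    have := ((contDiff_ellipticTwistPrimitive hT z μ).differentiable (by simp)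
      (γ 0)).hasFDerivAt.comp_hasDerivAt 0 hγ
    rwa [hγ0] at this
  have hX' := hX.unique hR.fst
  have hP2 := (((hasDerivAt_const (0 : ℝ) z.2).inner ℝ (hX.sub hγ.fst)).add
    ((((hY.sub_const z.2).inner ℝ (hX.sub_const z.1)).sub (hw.inner ℝ hu)).div_const 2)).add
    (((((hs0.mul hτ).sub hTs).const_mul μ)).div_const 2)
  rw [hP.unique hP2, ← hX']
  have hCS := Real.sin_sq_add_cos_sq (deriv T (ellipticSq z μ y))
  simp only [hγ0, ellipticTwist, Pi.add_apply, Pi.sub_apply, Pi.smul_apply', inner_zero_left]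
  clear hP2 hP hR hX' hY hX hτ' hτ hTs hs0 hs' hu hw
  have hsq : ellipticSq z μ y = ‖y.1 - z.1‖ ^ 2 + ‖y.2 - z.2‖ ^ 2 / μ ^ 2 := rfl
  generalize ellipticSq z μ y = s at *
  generalize deriv T s = τ at *
  have hy1 : y.1 = z.1 + (y.1 - z.1) := by abel
  have hy2 : y.2 = z.2 + (y.2 - z.2) := by abel
  generalize y.1 - z.1 = u at *
  generalize y.2 - z.2 = w at *
  rw [← real_inner_self_eq_norm_sq, ← real_inner_self_eq_norm_sq] at hsq
  rw [hy2]
  generalize Real.cos τ = C at *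
  generalize Real.sin τ = S at *
  simp only [inner_add_left, inner_add_right, real_inner_smul_left, real_inner_smul_right,
    inner_neg_left, inner_neg_right, sub_eq_add_neg, add_assoc, hsq, real_inner_comm u w,
    real_inner_comm u h.2, real_inner_comm u h.1, real_inner_comm w h.1, real_inner_comm w h.2]
  field_simp
  linear_combination (μ * ⟪u, h.2⟫ - μ * ⟪w, h.1⟫ - τ' * μ ^ 2 * ⟪u, u⟫ - τ' * ⟪w, w⟫) * hCS

end LocalModel

/-! ### Sweeping coincidences to infinity over a ball -/

section Removal

open Filter Topology Set
open scoped RealInnerProductSpace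

/-- A sequence of functions which is locally eventually constant has a limit which locally agrees
with the late members of the sequence. -/
theorem exists_eventuallyEq_of_locally_eventually_const {X Y : Type*} [TopologicalSpace X]
    (F : ℕ → X → Y)
    (h : ∀ p, ∃ U ∈ 𝓝 p, ∃ k₀, ∀ k ≥ k₀, ∀ q ∈ U, F (k + 1) q = F k q) :
    ∃ G : X → Y, ∀ p, ∃ k₀, ∀ k ≥ k₀, G =ᶠ[𝓝 p] F k := by
  have h' : ∀ p, ∃ U ∈ 𝓝 p, ∃ k₀, ∀ k ≥ k₀, ∀ q ∈ U, F k q = F k₀ q := by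
    intro p
    obtain ⟨U, hU, k₀, hk⟩ := h p
    refine ⟨U, hU, k₀, fun k hk₀ q hq => ?_⟩
    induction k, hk₀ using Nat.le_induction with
    | base => rfl
    | succ k hk₀ ih => rw [hk k hk₀ q hq, ih]
  choose U hU k₀ hk using h'
  refine ⟨fun p => F (k₀ p) p, fun p => ⟨k₀ p, fun k hkp => ?_⟩⟩
  filter_upwards [hU p] with q hq
  rw [hk p k hkp q hq]
  -- The value at `q` was read off at its own index `k₀ q`. Whichever index is smaller, its
  -- neighbourhood contains `q` and settles the comparison.
  rcases le_total (k₀ p) (k₀ q) with h1 | h1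
  · exact hk p _ h1 q hq
  · exact (hk q _ h1 q (mem_of_mem_nhds (hU q))).symm

/-- A profile function for `ellipticTwist`. -/
theorem exists_twistProfile {a b : ℝ} (hab : a < b) :
    ∃ T : ℝ → ℝ, ContDiff ℝ ∞ T ∧ (∀ s < a, deriv T s = Real.pi) ∧
      ∀ s > b, T s = 0 ∧ deriv T s = 0 := by
  let χ : ℝ → ℝ := fun s => Real.smoothTransition ((b - s) / (b - a))
  have hχ : ContDiff ℝ ∞ χ :=
    Real.smoothTransition.contDiff.comp ((contDiff_const.sub contDiff_id).div_const _)
  have hba : 0 < b - a := sub_pos.2 hab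
  refine ⟨fun s => Real.pi * s * χ s, (contDiff_const.mul contDiff_id).mul hχ, fun s hs => ?_,
    fun s hs => ?_⟩
  · have : (fun s => Real.pi * s * χ s) =ᶠ[𝓝 s] fun s => Real.pi * s := by
      filter_upwards [Iio_mem_nhds hs] with t ht
      have : χ t = 1 := Real.smoothTransition.one_of_one_le (by
        rw [le_div_iff₀ hba]; linarith [mem_Iio.1 ht])
      rw [this, mul_one]
    rw [this.deriv_eq]
    simp
  · have h0 : ∀ t > b, Real.pi * t * χ t = 0 := fun t ht => by
      have : χ t = 0 := Real.smoothTransition.zero_of_nonpos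
        (div_nonpos_of_nonpos_of_nonneg (by linarith) hba.le)
      rw [this, mul_zero]
    have : (fun s => Real.pi * s * χ s) =ᶠ[𝓝 s] fun _ => 0 := by
      filter_upwards [Ioi_mem_nhds hs] with t ht using h0 t ht
    exact ⟨h0 s hs, by rw [this.deriv_eq, deriv_const]⟩

theorem norm_fst_sub_sq_le_ellipticSq {E : Type*} [NormedAddCommGroup E] (z : E × E) (μ : ℝ)
    (y : E × E) : ‖y.1 - z.1‖ ^ 2 ≤ ellipticSq z μ y :=
  le_add_of_nonneg_right (by positivity)

theorem norm_snd_sub_sq_le_ellipticSq {E : Type*} [NormedAddCommGroup E] (z : E × E) (μ : ℝ)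
    (y : E × E) : ‖y.2 - z.2‖ ^ 2 / μ ^ 2 ≤ ellipticSq z μ y :=
  le_add_of_nonneg_left (by positivity)

variable {E : Type*} [NormedAddCommGroup E] [InnerProductSpace ℝ E]

theorem ellipticTwist_of_deriv_eq_zero {T : ℝ → ℝ} {z : E × E} {μ : ℝ} {y : E × E}
    (h : deriv T (ellipticSq z μ y) = 0) : ellipticTwist T z μ y = y := by
  simp [ellipticTwist, h]

theorem ellipticTwistPrimitive_of_eq_zero {T : ℝ → ℝ} {z : E × E} {μ : ℝ} {y : E × E}
    (h : deriv T (ellipticSq z μ y) = 0) (h0 : T (ellipticSq z μ y) = 0) :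
    ellipticTwistPrimitive T z μ y = 0 := by
  simp [ellipticTwistPrimitive, ellipticTwist_of_deriv_eq_zero h, h, h0]

theorem ellipticTwist_of_deriv_eq_pi {T : ℝ → ℝ} {z : E × E} {μ : ℝ} {y : E × E}
    (h : deriv T (ellipticSq z μ y) = Real.pi) :
    ellipticTwist T z μ y = (z.1 - (y.1 - z.1), z.2 - (y.2 - z.2)) := by
  simp only [ellipticTwist, h, Real.cos_pi, Real.sin_pi]
  ext1 <;> simp [sub_eq_add_neg, add_comm]

/-- If the difference of `dg` and the tautological form vanishes at the image of a point under a
symplectic twist, then so does the corresponding difference for the pullback. -/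
theorem fderiv_eq_modelTaut_of_twist {T : ℝ → ℝ} (hT : ContDiff ℝ ∞ T) (z : E × E) {μ : ℝ}
    (hμ : 0 < μ) {g : E × E → ℝ} {y : E × E}
    (hg : DifferentiableAt ℝ g (ellipticTwist T z μ y))
    (h : fderiv ℝ (fun y => g (ellipticTwist T z μ y) - ellipticTwistPrimitive T z μ y) y =
      modelTaut y) :
    fderiv ℝ g (ellipticTwist T z μ y) = modelTaut (ellipticTwist T z μ y) := by
  have hd := (contDiff_ellipticTwist hT z μ).differentiable (by simp) y
  have hp := (contDiff_ellipticTwistPrimitive hT z μ).differentiable (by simp) y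
  have h1 := (hg.hasFDerivAt.comp y hd.hasFDerivAt).sub hp.hasFDerivAt
  refine ContinuousLinearMap.ext fun v => ?_
  obtain ⟨w, rfl⟩ := surjective_fderiv_ellipticTwist hT z hμ y v
  have h2 := congrArg (fun L => L w) (h1.fderiv.symm.trans h)
  simp only [sub_apply, ContinuousLinearMap.comp_apply,
    fderiv_ellipticTwistPrimitive hT z hμ, modelTaut_apply] at h2 ⊢
  linarith

/-- If `fderiv ℝ g` agrees with the tautological form only over the ball of radius `ρ` and at
bounded covectors, then `g` can be modified over a larger ball so that they agree nowhere over
that ball. -/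
theorem exists_removal [Nontrivial E] {U : Set E} (hU : IsOpen U) {x₀ : E} {ρ r : ℝ}
    (hρ : 0 ≤ ρ) (hρr : ρ < r) (hrU : Metric.closedBall x₀ r ⊆ U) {g : E × E → ℝ}
    (hg : ContDiffOn ℝ ∞ g (U ×ˢ univ)) {R : ℝ}
    (hZ : ∀ y : E × E, ‖y.1 - x₀‖ ≤ r → fderiv ℝ g y = modelTaut y → ‖y.1 - x₀‖ ≤ ρ ∧ ‖y.2‖ ≤ R) :
    ∃ g' : E × E → ℝ, ∃ r' < r, ContDiffOn ℝ ∞ g' (U ×ˢ univ) ∧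
      (∀ y : E × E, r' < ‖y.1 - x₀‖ → g' y = g y) ∧
      ∀ y : E × E, ‖y.1 - x₀‖ ≤ r → fderiv ℝ g' y ≠ modelTaut y := by
  have hUo : IsOpen (U ×ˢ (univ : Set E)) := hU.prod isOpen_univ
  obtain ⟨e, he⟩ := exists_norm_eq E zero_le_one
  obtain ⟨r', hρr', hr'⟩ := exists_between hρr
  have hr'0 : 0 < r' := hρ.trans_lt hρr'
  obtain ⟨a, hρa, har⟩ := exists_between (pow_lt_pow_left₀ hρr' hρ two_ne_zero)
  obtain ⟨T, hT, hTa, hTb⟩ := exists_twistProfile har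
  -- A large `μ` stretches the ellipsoids along the fibre, so that the region of exact half turns
  -- contains all covectors within `R + 1` of the centre over the `ρ`-ball.
  obtain ⟨μ, hμ, hμa⟩ : ∃ μ : ℝ, 0 < μ ∧ ρ ^ 2 + (R + 1) ^ 2 / μ ^ 2 < a := by
    have : Tendsto (fun μ : ℝ => ρ ^ 2 + (R + 1) ^ 2 / μ ^ 2) atTop (𝓝 (ρ ^ 2 + 0)) :=
      tendsto_const_nhds.add
        (tendsto_const_nhds.div_atTop (tendsto_pow_atTop two_ne_zero))
    rw [add_zero] at this
    exact ((eventually_gt_atTop 0).and (this.eventually_lt_const hρa)).exists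
  -- The half-integer makes the point reflection about `z k` exchange `(x₀, k • e)` and `(x₀, (k +
  -- 1) • e)`.
  let z : ℕ → E × E := fun k => (x₀, ((k : ℝ) + 1 / 2) • e)
  let F : ℕ → E × E → ℝ := fun k => Nat.rec g (fun k f y =>
    f (ellipticTwist T (z k) μ y) - ellipticTwistPrimitive T (z k) μ y) k
  have hF : ∀ k y, F (k + 1) y = F k (ellipticTwist T (z k) μ y) -
    ellipticTwistPrimitive T (z k) μ y := fun k y => rfl
  have hout : ∀ k y, r' ^ 2 < ellipticSq (z k) μ y → ellipticTwist T (z k) μ y = y ∧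
      F (k + 1) y = F k y := by
    intro k y h
    have h1 := ellipticTwist_of_deriv_eq_zero (hTb _ h).2
    refine ⟨h1, ?_⟩
    rw [hF, h1, ellipticTwistPrimitive_of_eq_zero (hTb _ h).2 (hTb _ h).1, sub_zero]
  have hout1 : ∀ k (y : E × E), r' < ‖y.1 - x₀‖ → r' ^ 2 < ellipticSq (z k) μ y := fun k y h =>
    (pow_lt_pow_left₀ h hr'0.le two_ne_zero).trans_le (norm_fst_sub_sq_le_ellipticSq (z k) μ y)
  have hball : ∀ k (y : E × E), ‖y.1 - x₀‖ ≤ r → ‖(ellipticTwist T (z k) μ y).1 - x₀‖ ≤ r := by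
    intro k y h
    rcases lt_or_ge (r' ^ 2) (ellipticSq (z k) μ y) with h1 | h1
    · rwa [(hout k y h1).1]
    · refine le_trans (abs_le_of_sq_le_sq' ?_ hr'0.le).2 hr'.le
      refine le_trans (norm_fst_sub_sq_le_ellipticSq (z k) μ _) ?_
      rwa [ellipticSq_ellipticTwist T _ hμ]
  have hmaps : ∀ k, MapsTo (ellipticTwist T (z k) μ) (U ×ˢ univ) (U ×ˢ univ) := by
    intro k y hy
    rcases lt_or_ge r (‖y.1 - x₀‖) with h1 | h1
    · rwa [(hout k y (hout1 k y (hr'.trans h1))).1]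
    · exact ⟨hrU (mem_closedBall_iff_norm.2 (hball k y h1)), mem_univ _⟩
  have hsmooth : ∀ k, ContDiffOn ℝ ∞ (F k) (U ×ˢ univ) := by
    intro k
    induction k with
    | zero => exact hg
    | succ k ih =>
      exact (ih.comp (contDiff_ellipticTwist hT (z k) μ).contDiffOn (hmaps k)).sub
        (contDiff_ellipticTwistPrimitive hT (z k) μ).contDiffOn
  -- A coincidence `y` of `F (k + 1)` is carried by the twist to one of `F k`, near `k • e`. That
  -- point lies in the half-turn region, and reflecting it back puts `y` near `(k + 1) • e`.
  have hbad : ∀ k, ∀ y : E × E, ‖y.1 - x₀‖ ≤ r → fderiv ℝ (F k) y = modelTaut y →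
      ‖y.1 - x₀‖ ≤ ρ ∧ ‖y.2 - (k : ℝ) • e‖ ≤ R := by
    intro k
    induction k with
    | zero =>
      intro y hy hyb
      simpa using hZ y hy hyb
    | succ k ih =>
      intro y hy hyb
      have hyU : ellipticTwist T (z k) μ y ∈ U ×ˢ (univ : Set E) :=
        hmaps k ⟨hrU (mem_closedBall_iff_norm.2 hy), mem_univ _⟩
      have h1 := fderiv_eq_modelTaut_of_twist hT (z k) hμ
        (((hsmooth k).contDiffAt (hUo.mem_nhds hyU)).differentiableAt (by simp)) hyb
      obtain ⟨h2, h3⟩ := ih _ (hball k y hy) h1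
      have hs : ellipticSq (z k) μ y < a := by
        rw [← ellipticSq_ellipticTwist T _ hμ]
        refine lt_of_le_of_lt ?_ hμa
        have h4 : ‖(ellipticTwist T (z k) μ y).2 - (z k).2‖ ≤ R + 1 := by
          have : (ellipticTwist T (z k) μ y).2 - (z k).2 =
            ((ellipticTwist T (z k) μ y).2 - (k : ℝ) • e) - (1 / 2 : ℝ) • e := by
            simp only [z]; module
          rw [this]
          refine (norm_sub_le _ _).trans (add_le_add h3 ?_)
          rw [norm_smul, he]; norm_num
        unfold ellipticSq
        gcongr
      rw [ellipticTwist_of_deriv_eq_pi (hTa _ hs)] at h2 h3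
      have e1 : (z k).1 - (y.1 - (z k).1) - x₀ = -(y.1 - x₀) := by simp only [z]; abel
      have e2 : (z k).2 - (y.2 - (z k).2) - (k : ℝ) • e = -(y.2 - ((k + 1 : ℕ) : ℝ) • e) := by
        simp only [z]; push_cast; module
      simp only [e1, e2, norm_neg] at h2 h3
      exact ⟨h2, h3⟩
  -- The support of the `k`-th twist has fibre radius at most `μ * r'` about `(k + 1 / 2) • e`, so
  -- it leaves every bounded set of covectors.
  have hstab : ∀ M : ℝ, ∃ k₀ : ℕ, ∀ k ≥ k₀, ∀ y : E × E, ‖y.2‖ < M →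
      F (k + 1) y = F k y := by
    intro M
    obtain ⟨k₀, hk₀⟩ := exists_nat_gt (M + μ * r')
    refine ⟨k₀, fun k hk y hy => (hout k y ?_).2⟩
    have h1 : μ * r' < ‖y.2 - (z k).2‖ := by
      have h2 : ‖(z k).2‖ = (k : ℝ) + 1 / 2 := by
        simp only [z, norm_smul, he, mul_one]
        exact abs_of_nonneg (by positivity)
      have h3 := norm_sub_norm_le (z k).2 y.2
      rw [norm_sub_rev] at h3
      have h4 : (k₀ : ℝ) ≤ k := by exact_mod_cast hk
      linarith
    refine lt_of_lt_of_le ?_ (norm_snd_sub_sq_le_ellipticSq (z k) μ y)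
    rw [lt_div_iff₀ (by positivity), ← mul_pow, mul_comm r']
    exact pow_lt_pow_left₀ h1 (by positivity) two_ne_zero
  obtain ⟨G, hG⟩ := exists_eventuallyEq_of_locally_eventually_const F fun p => by
    obtain ⟨k₀, hk₀⟩ := hstab (‖p.2‖ + 1)
    refine ⟨{q | ‖q.2‖ < ‖p.2‖ + 1}, ?_, k₀, fun k hk q hq => hk₀ k hk q hq⟩
    exact (isOpen_lt (by fun_prop) continuous_const).mem_nhds (lt_add_one ‖p.2‖)
  refine ⟨G, r', hr', fun y hy => ?_, fun y hy => ?_, fun y hy hyb => ?_⟩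
  · obtain ⟨k, hk⟩ := hG y
    exact (((hsmooth k).contDiffAt (hUo.mem_nhds hy)).congr_of_eventuallyEq
      (hk k le_rfl)).contDiffWithinAt
  · obtain ⟨k, hk⟩ := hG y
    rw [(hk k le_rfl).self_of_nhds]
    clear hk
    induction k with
    | zero => rfl
    | succ k ih => rw [(hout k y (hout1 k y hy)).2, ih]
  -- Near `y` the limit equals `F k` for all large `k`, whose coincidences over the ball have
  -- covectors of norm at least `k - R`.
  · obtain ⟨k, hk⟩ := hG y
    obtain ⟨j, hj⟩ := exists_nat_gt (‖y.2‖ + R)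
    have h1 := (hk (max k j) (le_max_left _ _)).fderiv_eq (𝕜 := ℝ)
    have h2 := (hbad (max k j) y hy (h1.symm.trans hyb)).2
    have h3 := norm_sub_norm_le (((max k j : ℕ) : ℝ) • e) y.2
    rw [norm_sub_rev, norm_smul, he, mul_one, Real.norm_natCast] at h3
    have h4 : (j : ℝ) ≤ (max k j : ℕ) := by exact_mod_cast le_max_right k j
    linarith

end Removal

/-! ### Clearing a sphere by a small perturbation -/

section Perturbation

open Filter Topology Set MeasureTheory
open scoped RealInnerProductSpace

/-- With `c = χ y` and `ℓ'` the differential of `χ` at `y`, the left side is the differential of `χ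
* ℓ`. The bound shows that it is small with `ℓ`. -/
theorem norm_smul_add_smul_le {V : Type*} [NormedAddCommGroup V] [NormedSpace ℝ V] (c : ℝ)
    (ℓ ℓ' : V →L[ℝ] ℝ) (y : V) : ‖c • ℓ + ℓ y • ℓ'‖ ≤ ‖ℓ‖ * (|c| + ‖y‖ * ‖ℓ'‖) := by
  refine (norm_add_le _ _).trans ?_
  rw [norm_smul, norm_smul, Real.norm_eq_abs]
  have := mul_le_mul_of_nonneg_right (ℓ.le_opNorm y) (norm_nonneg ℓ')
  linarith

theorem IsCompact.exists_pos_le_norm {X V : Type*} [TopologicalSpace X] [NormedAddCommGroup V]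
    {K : Set X} (hK : IsCompact K) {B : X → V} (hB : ContinuousOn B K) (h0 : ∀ x ∈ K, B x ≠ 0) :
    ∃ δ > 0, ∀ x ∈ K, δ ≤ ‖B x‖ :=
  hK.exists_forall_le' (a := 0) hB.norm fun x hx => norm_pos_iff.2 (h0 x hx)

variable {E : Type*} [NormedAddCommGroup E] [InnerProductSpace ℝ E]

theorem continuousOn_fderiv_sub_modelTaut {W : Set (E × E)} (hW : IsOpen W) {g : E × E → ℝ}
    (hg : ContDiffOn ℝ ∞ g W) : ContinuousOn (fun y => fderiv ℝ g y - modelTaut y) W :=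
  (hg.continuousOn_fderiv_of_isOpen hW (by simp)).sub modelTaut.continuous.continuousOn

variable [FiniteDimensional ℝ E]

/-- The values of `dg` minus the tautological form over a sphere form a null set, so that there are
arbitrarily small linear forms outside of it. -/
theorem exists_small_linear_form {U : Set E} (hU : IsOpen U) {g : E × E → ℝ}
    (hg : ContDiffOn ℝ ∞ g (U ×ˢ univ)) (x₀ : E) {r : ℝ} (hr : 0 < r)
    (hrU : Metric.sphere x₀ r ⊆ U) {ε : ℝ} (hε : 0 < ε) :
    ∃ ℓ : E × E →L[ℝ] ℝ, ‖ℓ‖ < ε ∧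
      ∀ y : E × E, ‖y.1 - x₀‖ = r → fderiv ℝ g y - modelTaut y ≠ ℓ := by
  borelize E
  have hfin : Module.finrank ℝ (E × E →L[ℝ] ℝ) = Module.finrank ℝ (E × E) := by
    rw [← (LinearMap.toContinuousLinearMap (𝕜 := ℝ) (E := E × E) (F' := ℝ)).finrank_eq]
    exact Subspace.dual_finrank_eq
  -- Identifying the dual with `E × E` gives a differentiable map of `E × E` to itself, which sends
  -- null sets to null sets.
  let L : (E × E →L[ℝ] ℝ) ≃L[ℝ] E × E := ContinuousLinearEquiv.ofFinrankEq hfin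
  let S : Set (E × E) := Metric.sphere x₀ r ×ˢ univ
  have hSU : S ⊆ U ×ˢ univ := prod_mono hrU subset_rfl
  have hS : ((volume : Measure E).prod (volume : Measure E)) S = 0 := by
    rw [Measure.prod_prod, Measure.addHaar_sphere_of_ne_zero _ _ hr.ne', zero_mul]
  have hd : DifferentiableOn ℝ (fun y => L (fderiv ℝ g y - modelTaut y)) S := by
    refine DifferentiableOn.mono ?_ hSU
    refine (L : (E × E →L[ℝ] ℝ) →L[ℝ] E × E).differentiable.comp_differentiableOn ?_
    exact ((hg.fderiv_of_isOpen (m := 1) (hU.prod isOpen_univ) (by norm_cast)).differentiableOn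
      (by simp)).sub (modelTaut (E := E)).differentiable.differentiableOn
  have hnull := addHaar_image_eq_zero_of_differentiableOn_of_addHaar_eq_zero
    ((volume : Measure E).prod (volume : Measure E)) hd hS
  have : (volume : Measure E).IsAddHaarMeasure := inferInstance
  have hdense := Measure.dense_of_ae (compl_mem_ae_iff.2 hnull)
  obtain ⟨ℓ, hℓ, hz⟩ := hdense.exists_mem_open
    (Metric.isOpen_ball.preimage L.symm.continuous : IsOpen (L.symm ⁻¹' Metric.ball 0 ε))
    ⟨0, by simpa only [mem_preimage, map_zero] using Metric.mem_ball_self hε⟩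
  refine ⟨L.symm ℓ, (mem_ball_zero_iff (E := E × E →L[ℝ] ℝ)).1 hz, fun y hy h => hℓ ⟨y, ?_, ?_⟩⟩
  · exact ⟨by simpa [dist_eq_norm] using hy, mem_univ _⟩
  · change L (fderiv ℝ g y - modelTaut y) = ℓ
    rw [h, L.apply_symm_apply]

/-- A small perturbation of `g` over a compact set makes `dg` different from the tautological form
over a given sphere, without introducing new coincidences over a given set `A`. -/
theorem exists_perturbation {U : Set E} (hU : IsOpen U) {x₀ : E} {r s : ℝ}
    (hr : 0 < r) (hrs : r < s) (hsU : Metric.closedBall x₀ s ⊆ U) {g : E × E → ℝ}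
    (hg : ContDiffOn ℝ ∞ g (U ×ˢ univ)) {R : ℝ}
    (hZ : ∀ y : E × E, ‖y.1 - x₀‖ ≤ s → fderiv ℝ g y = modelTaut y → ‖y.2‖ ≤ R)
    {A : Set E} (hA : IsClosed A) (hAg : ∀ y : E × E, y.1 ∈ A → fderiv ℝ g y ≠ modelTaut y) :
    ∃ g' : E × E → ℝ, ∃ R' : ℝ, ContDiffOn ℝ ∞ g' (U ×ˢ univ) ∧
      (∀ y : E × E, y ∉ Metric.closedBall x₀ s ×ˢ Metric.closedBall 0 R' → g' y = g y) ∧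
      (∀ y : E × E, ‖y.1 - x₀‖ = r → fderiv ℝ g' y ≠ modelTaut y) ∧
      ∀ y : E × E, y.1 ∈ A → fderiv ℝ g' y ≠ modelTaut y := by
  have hUo : IsOpen (U ×ˢ (univ : Set E)) := hU.prod isOpen_univ
  obtain ⟨q, hrq, hqs⟩ := exists_between hrs
  let b₁ : ContDiffBump x₀ := ⟨q, s, hr.trans hrq, hqs⟩
  let b₂ : ContDiffBump (0 : E) := ⟨|R| + 1, |R| + 2, by positivity, by linarith⟩
  let χ : E × E → ℝ := fun y => b₁ y.1 * b₂ y.2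
  have hχ : ContDiff ℝ ∞ χ := (b₁.contDiff.comp contDiff_fst).mul (b₂.contDiff.comp contDiff_snd)
  have hχd : Differentiable ℝ χ := hχ.differentiable (by simp)
  let Q : Set (E × E) := Metric.closedBall x₀ s ×ˢ Metric.closedBall 0 (|R| + 2)
  have hQ : IsCompact Q := (isCompact_closedBall _ _).prod (isCompact_closedBall _ _)
  have hQU : Q ⊆ U ×ˢ univ := prod_mono hsU (subset_univ _)
  have hχ0 : ∀ y ∉ Q, χ y = 0 := by
    intro y hy
    rw [mem_prod, not_and_or] at hy
    rcases hy with hy | hy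
    · have : b₁ y.1 = 0 := b₁.zero_of_le_dist (not_le.1 hy).le
      simp [χ, this]
    · have : b₂ y.2 = 0 := b₂.zero_of_le_dist (not_le.1 hy).le
      simp [χ, this]
  have hχ1 : ∀ y : E × E, ‖y.1 - x₀‖ = r → ‖y.2‖ < |R| + 1 → χ =ᶠ[𝓝 y] fun _ => 1 := by
    intro y h1 h2
    have hopen : IsOpen {y : E × E | ‖y.1 - x₀‖ < q ∧ ‖y.2‖ < |R| + 1} :=
      (isOpen_lt (f := fun y : E × E => ‖y.1 - x₀‖) (by fun_prop) continuous_const).inter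
        (isOpen_lt (f := fun y : E × E => ‖y.2‖) (by fun_prop) continuous_const)
    filter_upwards [hopen.mem_nhds ⟨by rwa [h1], h2⟩] with w hw
    have h3 : b₁ w.1 = 1 := b₁.one_of_mem_closedBall (mem_closedBall_iff_norm.2 hw.1.le)
    have h4 : b₂ w.2 = 1 := b₂.one_of_mem_closedBall (mem_closedBall_zero_iff.2 hw.2.le)
    simp [χ, h3, h4]
  let B : E × E → (E × E →L[ℝ] ℝ) := fun y => fderiv ℝ g y - modelTaut y
  have hB : ContinuousOn B (U ×ˢ univ) := continuousOn_fderiv_sub_modelTaut hUo hg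
  -- On `K` the perturbation could create coincidences: over the sphere where `χ` may differ from
  -- `1`, or over `A`. There `dg - θ` is nonzero, hence bounded below by compactness, and a small
  -- `ℓ` does no harm.
  let K : Set (E × E) := Q ∩ {y | (‖y.1 - x₀‖ = r ∧ |R| + 1 ≤ ‖y.2‖) ∨ y.1 ∈ A}
  have hK : IsCompact K := hQ.inter_right <|
    ((isClosed_eq (f := fun y : E × E => ‖y.1 - x₀‖) (by fun_prop) continuous_const).inter
      (isClosed_le (g := fun y : E × E => ‖y.2‖) continuous_const (by fun_prop))).union
        (hA.preimage continuous_fst)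
  have hBK : ∀ y ∈ K, B y ≠ 0 := by
    rintro y ⟨hyQ, hy⟩
    refine sub_ne_zero.2 ?_
    rcases hy with ⟨h1, h2⟩ | hy
    · intro h
      have := hZ y (by rw [h1]; exact hrs.le) h
      linarith [le_abs_self R]
    · exact hAg y hy
  obtain ⟨δ, hδ, hδB⟩ : ∃ δ > 0, ∀ y ∈ K, δ ≤ ‖B y‖ := by
    exact hK.exists_pos_le_norm (V := E × E →L[ℝ] ℝ) (B := B)
      (hB.mono (inter_subset_left.trans hQU)) hBK
  obtain ⟨C, hC⟩ := hQ.exists_bound_of_continuousOn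
    (f := fun y => |χ y| + ‖y‖ * ‖fderiv ℝ χ y‖)
    ((hχ.continuous.abs.add (continuous_norm.mul
      (hχ.continuous_fderiv (by simp)).norm)).continuousOn)
  have hC1 : 0 < |C| + 1 := by positivity
  obtain ⟨ℓ, hℓ, hℓB⟩ := exists_small_linear_form hU hg x₀ hr
    ((Metric.sphere_subset_closedBall.trans (Metric.closedBall_subset_closedBall hrs.le)).trans hsU)
    (div_pos hδ hC1)
  let g' : E × E → ℝ := fun y => g y - χ y * ℓ y
  have hd' : ∀ y ∈ U ×ˢ (univ : Set E), fderiv ℝ g' y = fderiv ℝ g y -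
      (χ y • ℓ + ℓ y • fderiv ℝ χ y) := by
    intro y hy
    have h1 : DifferentiableAt ℝ g y :=
      (hg.contDiffAt (hUo.mem_nhds hy)).differentiableAt (by simp)
    exact (h1.hasFDerivAt.sub ((hχd y).hasFDerivAt.mul ℓ.hasFDerivAt)).fderiv
  have heq : ∀ y ∉ Q, fderiv ℝ g' y = fderiv ℝ g y := by
    intro y hy
    refine Filter.EventuallyEq.fderiv_eq ?_
    filter_upwards [hQ.isClosed.isOpen_compl.mem_nhds hy] with w hw
    simp [g', hχ0 w hw]
  have hKg : ∀ y ∈ K, fderiv ℝ g' y ≠ modelTaut y := by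
    intro y hy h
    rw [hd' y (hQU hy.1)] at h
    have h1 : B y = χ y • ℓ + ℓ y • fderiv ℝ χ y := by
      simp only [B]
      rw [← h]
      abel
    have h2 : ‖B y‖ ≤ ‖ℓ‖ * (|χ y| + ‖y‖ * ‖fderiv ℝ χ y‖) := by
      rw [h1]
      exact norm_smul_add_smul_le _ _ _ _
    have h3 : |χ y| + ‖y‖ * ‖fderiv ℝ χ y‖ ≤ |C| + 1 := by
      have := (le_abs_self _).trans (hC y hy.1)
      linarith [le_abs_self C]
    have h4 := mul_le_mul_of_nonneg_left h3 (norm_nonneg ℓ)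
    rw [lt_div_iff₀ hC1] at hℓ
    linarith [hδB y hy]
  refine ⟨g', |R| + 2, hg.sub ((hχ.mul ℓ.contDiff).contDiffOn), fun y hy => ?_,
    fun y hy => ?_, fun y hy => ?_⟩
  · simp [g', hχ0 y hy]
  · by_cases hyQ : y ∈ Q
    -- Where `χ` is locally `1`, the new difference is `dg - θ - ℓ`, nonzero because `ℓ` is a missed
    -- value.
    · rcases lt_or_ge ‖y.2‖ (|R| + 1) with h1 | h1
      · have h2 := hχ1 y hy h1
        rw [hd' y (hQU hyQ), h2.fderiv_eq, h2.self_of_nhds]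
        intro h
        refine hℓB y hy ?_
        rw [← h]
        simp
      · exact hKg y ⟨hyQ, Or.inl ⟨hy, h1⟩⟩
    · rw [heq y hyQ]
      intro h
      have := hZ y (by rw [hy]; exact hrs.le) h
      refine hyQ ⟨mem_closedBall_iff_norm.2 (by rw [hy]; exact hrs.le),
        mem_closedBall_zero_iff.2 ?_⟩
      linarith [le_abs_self R]
  · by_cases hyQ : y ∈ Q
    · exact hKg y ⟨hyQ, Or.inr hy⟩
    · rw [heq y hyQ]
      exact hAg y hy

end Perturbation

/-! ### The charts of `T*N` are canonical coordinates -/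

section CotangentCharts

open Filter Topology Set

variable {E : Type*} [NormedAddCommGroup E] [NormedSpace ℝ E]
  {N : Type*} [TopologicalSpace N] [ChartedSpace E N] [IsManifold 𝓘(ℝ, E) ∞ N]

local notation "J" => ModelWithCorners.prod 𝓘(ℝ, E) 𝓘(ℝ, E →L[ℝ] ℝ)

local notation "T⋆" => CotangentBundle 𝓘(ℝ, E) N

instance cotangentBundle_isManifold : IsManifold J ∞ T⋆ := by
  have : ContMDiffVectorBundle ∞ E (fun x : N => TangentSpace 𝓘(ℝ, E) x) 𝓘(ℝ, E) := by
    -- The tangent bundle loses one derivative, which costs nothing since `∞ + 1 = ∞`.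
    have : IsManifold 𝓘(ℝ, E) (∞ + 1) N := ‹IsManifold 𝓘(ℝ, E) ∞ N›
    infer_instance
  infer_instance

theorem cotangent_extChartAt_target (p : T⋆) :
    (extChartAt J p).target = (chartAt E p.proj).target ×ˢ univ := by
  rw [FiberBundle.extChartAt_target]
  congr 1
  ext x
  simp only [mfld_simps]
  exact ⟨fun h => h.1, fun h => ⟨h, (chartAt E p.proj).map_target h, mem_univ _⟩⟩

theorem mem_cotangent_extChartAt_source {p q : T⋆} :
    q ∈ (extChartAt J p).source ↔ q.proj ∈ (chartAt E p.proj).source := by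
  rw [extChartAt_source, FiberBundle.chartedSpace_chartAt]
  constructor
  · intro h
    have h1 := h.2.1
    simp only [mfld_simps] at h1
    exact h1
  · intro h
    refine ⟨⟨h, mem_univ _⟩, ?_, mem_univ _⟩
    simp only [mfld_simps]
    exact h

theorem cotangent_extChartAt_fst (p q : T⋆) :
    (extChartAt J p q).1 = chartAt E p.proj q.proj := by
  rw [FiberBundle.extChartAt]
  rfl

theorem cotangent_extChartAt_symm_proj {p : T⋆} {y : E × (E →L[ℝ] ℝ)}
    (hy : y ∈ (extChartAt J p).target) :
    ((extChartAt J p).symm y).proj = (chartAt E p.proj).symm y.1 := by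
  have h := cotangent_extChartAt_fst p ((extChartAt J p).symm y)
  rw [(extChartAt J p).right_inv hy] at h
  rw [h, (chartAt E p.proj).left_inv]
  exact mem_cotangent_extChartAt_source.1 ((extChartAt J p).map_target hy)

theorem isOpen_cotangent_extChartAt_target (p : T⋆) : IsOpen (extChartAt J p).target := by
  rw [cotangent_extChartAt_target]
  exact (chartAt E p.proj).open_target.prod isOpen_univ

/-- This identifies the fibre coordinate of the bundle chart as the pullback of the covector under
the inverse base chart, so that `θ` gets its standard coordinate expression. -/
theorem cotangent_extChartAt_snd {p q : T⋆} (hq : q ∈ (extChartAt J p).source) :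
    (extChartAt J p q).2 = q.snd.comp
      (mfderiv 𝓘(ℝ, E) 𝓘(ℝ, E) (extChartAt 𝓘(ℝ, E) p.proj).symm (chartAt E p.proj q.proj)) := by
  have hq' := mem_cotangent_extChartAt_source.1 hq
  have h1 : (extChartAt J p q).2 = ContinuousLinearMap.inCoordinates E (TangentSpace 𝓘(ℝ, E)) ℝ
      (Bundle.Trivial N ℝ) p.proj q.proj p.proj q.proj q.snd := by
    rw [FiberBundle.extChartAt]
    rfl
  rw [h1]
  unfold ContinuousLinearMap.inCoordinates
  rw [TangentBundle.symmL_trivializationAt hq']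
  simp only [mfld_simps, mfderivWithin_univ]
  ext v
  simp
  rfl

theorem mfderiv_proj_symm {p : T⋆} {y : E × (E →L[ℝ] ℝ)}
    (hy : y ∈ (extChartAt J p).target) (h : E × (E →L[ℝ] ℝ)) :
    mfderiv J 𝓘(ℝ, E) (Bundle.TotalSpace.proj : T⋆ → N) ((extChartAt J p).symm y)
      (mfderiv 𝓘(ℝ, E × (E →L[ℝ] ℝ)) J (extChartAt J p).symm y h) =
    mfderiv 𝓘(ℝ, E) 𝓘(ℝ, E) (extChartAt 𝓘(ℝ, E) p.proj).symm y.1 h.1 := by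
  have ht : (extChartAt J p).target ∈ 𝓝 y := (isOpen_cotangent_extChartAt_target p).mem_nhds hy
  have hs : MDifferentiableAt 𝓘(ℝ, E × (E →L[ℝ] ℝ)) J (extChartAt J p).symm y :=
    (((contMDiffOn_extChartAt_symm (n := ∞) p).contMDiffAt ht).mdifferentiableAt (by simp))
  have hp : MDifferentiableAt J 𝓘(ℝ, E) (Bundle.TotalSpace.proj : T⋆ → N)
      ((extChartAt J p).symm y) :=
    (Bundle.contMDiff_proj (n := ∞) _).mdifferentiableAt (by simp)
  have hy1 : y.1 ∈ (extChartAt 𝓘(ℝ, E) p.proj).target := by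
    rw [cotangent_extChartAt_target] at hy
    simpa using hy.1
  have hφ : MDifferentiableAt 𝓘(ℝ, E) 𝓘(ℝ, E) (extChartAt 𝓘(ℝ, E) p.proj).symm y.1 :=
    ((contMDiffOn_extChartAt_symm (n := ∞) p.proj).contMDiffAt
      ((isOpen_extChartAt_target p.proj).mem_nhds hy1)).mdifferentiableAt (by simp)
  have hf : MDifferentiableAt 𝓘(ℝ, E × (E →L[ℝ] ℝ)) 𝓘(ℝ, E) Prod.fst y :=
    mdifferentiableAt_iff_differentiableAt.2 differentiableAt_fst
  have heq : (Bundle.TotalSpace.proj : T⋆ → N) ∘ (extChartAt J p).symm =ᶠ[𝓝 y]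
      (extChartAt 𝓘(ℝ, E) p.proj).symm ∘ Prod.fst := by
    filter_upwards [ht] with w hw
    simpa using cotangent_extChartAt_symm_proj hw
  have h1 := heq.mfderiv_eq (I := 𝓘(ℝ, E × (E →L[ℝ] ℝ))) (I' := 𝓘(ℝ, E))
  rw [mfderiv_comp y hp hs, mfderiv_comp y hφ hf, mfderiv_eq_fderiv, fderiv_fst] at h1
  exact congrArg (fun L => L h) h1

/-- The tautological form at a point, as a linear form. -/
def tautologicalLinear (q : T⋆) : TangentSpace J q →L[ℝ] ℝ :=
  q.snd.comp (mfderiv J 𝓘(ℝ, E) (Bundle.TotalSpace.proj : T⋆ → N) q)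

/-- The chart intertwines `π` with `Prod.fst`, and the derivative of the inverse base chart then
appears exactly as in the fibre coordinate. -/
theorem tautologicalLinear_symm {p : T⋆} {y : E × (E →L[ℝ] ℝ)}
    (hy : y ∈ (extChartAt J p).target) (h : E × (E →L[ℝ] ℝ)) :
    tautologicalLinear ((extChartAt J p).symm y)
      (mfderiv 𝓘(ℝ, E × (E →L[ℝ] ℝ)) J (extChartAt J p).symm y h) = y.2 h.1 := by
  have h1 := cotangent_extChartAt_snd ((extChartAt J p).map_target hy)
  have h2 := cotangent_extChartAt_fst p ((extChartAt J p).symm y)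
  rw [(extChartAt J p).right_inv hy] at h1 h2
  rw [← h2] at h1
  rw [h1]
  exact congrArg (fun v => ((extChartAt J p).symm y).snd v) (mfderiv_proj_symm hy h)

variable (f : CotangentBundle 𝓘(ℝ, E) N → ℝ)

/-- The differential of `f` at `q` agrees with the tautological form. -/
def DerivEqTaut (q : T⋆) : Prop :=
  ∀ v : TangentSpace J q, mfderiv J 𝓘(ℝ, ℝ) f q v = tautologicalLinear q v

variable {f}

theorem DerivEqTaut.congr {f' : T⋆ → ℝ} {q : T⋆} (h : f' =ᶠ[𝓝 q] f) :
    DerivEqTaut f' q ↔ DerivEqTaut f q := by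
  unfold DerivEqTaut
  rw [h.mfderiv_eq]
  rfl

theorem mdifferentiableAt_cotangent_symm {p : T⋆} {y : E × (E →L[ℝ] ℝ)}
    (hy : y ∈ (extChartAt J p).target) :
    MDifferentiableAt 𝓘(ℝ, E × (E →L[ℝ] ℝ)) J (extChartAt J p).symm y :=
  (((contMDiffOn_extChartAt_symm (n := ∞) p).contMDiffAt
    ((isOpen_cotangent_extChartAt_target p).mem_nhds hy)).mdifferentiableAt (by simp))

theorem surjective_mfderiv_cotangent_symm {p : T⋆} {y : E × (E →L[ℝ] ℝ)}
    (hy : y ∈ (extChartAt J p).target) :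
    Function.Surjective (mfderiv 𝓘(ℝ, E × (E →L[ℝ] ℝ)) J (extChartAt J p).symm y) := by
  have h := isInvertible_mfderivWithin_extChartAt_symm (I := J) hy
  rw [ModelWithCorners.range_eq_univ, mfderivWithin_univ] at h
  exact h.bijective.surjective

theorem derivEqTaut_symm_iff (hf : ContMDiff J 𝓘(ℝ, ℝ) ∞ f) {p : T⋆} {y : E × (E →L[ℝ] ℝ)}
    (hy : y ∈ (extChartAt J p).target) :
    DerivEqTaut f ((extChartAt J p).symm y) ↔
      ∀ h : E × (E →L[ℝ] ℝ), fderiv ℝ (f ∘ (extChartAt J p).symm) y h = y.2 h.1 := by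
  have hd : fderiv ℝ (f ∘ (extChartAt J p).symm) y =
      (mfderiv J 𝓘(ℝ, ℝ) f ((extChartAt J p).symm y)).comp
        (mfderiv 𝓘(ℝ, E × (E →L[ℝ] ℝ)) J (extChartAt J p).symm y) := by
    rw [← mfderiv_eq_fderiv]
    exact mfderiv_comp y (hf.mdifferentiableAt (by simp)) (mdifferentiableAt_cotangent_symm hy)
  unfold DerivEqTaut
  rw [(surjective_mfderiv_cotangent_symm hy).forall, hd]
  refine forall_congr' fun h => ?_
  rw [tautologicalLinear_symm hy h]
  rfl

theorem derivEqTaut_zero_iff {q : T⋆} : DerivEqTaut (fun _ : T⋆ => (0 : ℝ)) q ↔ q.snd = 0 := by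
  have hq : q ∈ (extChartAt J q).source := mem_extChartAt_source q
  have h := derivEqTaut_symm_iff (contMDiff_const (c := (0 : ℝ)))
    ((extChartAt J q).map_source hq)
  rw [(extChartAt J q).left_inv hq] at h
  rw [h]
  have h0 : ((fun _ : T⋆ => (0 : ℝ)) ∘ (extChartAt J q).symm) = fun _ => 0 := rfl
  rw [h0, cotangent_extChartAt_snd hq]
  have hinv := isInvertible_mfderivWithin_extChartAt_symm (I := 𝓘(ℝ, E))
    (mem_extChartAt_target (I := 𝓘(ℝ, E)) q.proj)
  rw [ModelWithCorners.range_eq_univ, mfderivWithin_univ, (extChartAt 𝓘(ℝ, E) q.proj).left_inv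
    (mem_extChartAt_source q.proj)] at hinv
  constructor
  · intro h1
    refine ContinuousLinearMap.ext fun v => ?_
    obtain ⟨w, rfl⟩ := hinv.bijective.surjective v
    have h2 := h1 (w, 0)
    rw [fderiv_fun_const] at h2
    exact h2.symm
  · intro h1 w
    rw [h1, fderiv_fun_const]
    rfl

end CotangentCharts

/-! ### Images of sets under inverse charts -/

section ChartImages

open Filter Topology Set

variable {E : Type*} [TopologicalSpace E] {N : Type*} [TopologicalSpace N] [ChartedSpace E N]
  {c : N}

theorem isCompact_chart_symm_image {D : Set E} (hD : IsCompact D) (hDU : D ⊆ (chartAt E c).target) :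
    IsCompact ((chartAt E c).symm '' D) :=
  hD.image_of_continuousOn ((chartAt E c).continuousOn_symm.mono hDU)

theorem chart_mem_of_mem_symm_image {D : Set E} (hDU : D ⊆ (chartAt E c).target) {x : N}
    (hx : x ∈ (chartAt E c).symm '' D) : x ∈ (chartAt E c).source ∧ chartAt E c x ∈ D := by
  obtain ⟨y, hy, rfl⟩ := hx
  exact ⟨(chartAt E c).map_target (hDU hy), by rwa [(chartAt E c).right_inv (hDU hy)]⟩

theorem mem_symm_image_of_chart_mem {D : Set E} {x : N} (hx : x ∈ (chartAt E c).source)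
    (h : chartAt E c x ∈ D) : x ∈ (chartAt E c).symm '' D :=
  ⟨_, h, (chartAt E c).left_inv hx⟩

end ChartImages

/-! ### Passing between `T*N` and the inner product model -/

section CotangentInner

open Filter Topology Set

theorem isOpen_proj_source {E : Type*} [NormedAddCommGroup E] [NormedSpace ℝ E] {N : Type*}
    [TopologicalSpace N] [ChartedSpace E N] [IsManifold 𝓘(ℝ, E) ∞ N] {c : N} :
    IsOpen {q : CotangentBundle 𝓘(ℝ, E) N | q.proj ∈ (chartAt E c).source} :=
  (chartAt E c).open_source.preimage (FiberBundle.continuous_proj _ _)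

variable {E : Type*} [NormedAddCommGroup E] [InnerProductSpace ℝ E] [CompleteSpace E]

variable (E) in
/-- The identification of `E × E` with `E × E*` by the Riesz isomorphism. -/
def prodDualEquiv : (E × E) ≃L[ℝ] E × (E →L[ℝ] ℝ) :=
  (ContinuousLinearEquiv.refl ℝ E).prodCongr
    (InnerProductSpace.toDual ℝ E).toContinuousLinearEquiv

variable {N : Type*} [TopologicalSpace N] [ChartedSpace E N] [IsManifold 𝓘(ℝ, E) ∞ N]

local notation "J" => ModelWithCorners.prod 𝓘(ℝ, E) 𝓘(ℝ, E →L[ℝ] ℝ)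

local notation "T⋆" => CotangentBundle 𝓘(ℝ, E) N

/-- The canonical coordinates on `T*N` given by the preferred chart of `N` at `c`. -/
def cotCoord (c : N) (q : T⋆) : E × E :=
  (prodDualEquiv E).symm (extChartAt J (⟨c, 0⟩ : T⋆) q)

/-- The inverse of `cotCoord c`. -/
def cotParam (c : N) (z : E × E) : T⋆ :=
  (extChartAt J (⟨c, 0⟩ : T⋆)).symm (prodDualEquiv E z)

variable {c : N}

theorem prodDualEquiv_mem_target {z : E × E} :
    prodDualEquiv E z ∈ (extChartAt J (⟨c, 0⟩ : T⋆)).target ↔ z.1 ∈ (chartAt E c).target := by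
  rw [cotangent_extChartAt_target]
  exact ⟨fun h => h.1, fun h => ⟨h, mem_univ _⟩⟩

theorem cotCoord_fst (q : T⋆) : (cotCoord c q).1 = chartAt E c q.proj :=
  cotangent_extChartAt_fst (⟨c, 0⟩ : T⋆) q

theorem cotParam_proj {z : E × E} (hz : z.1 ∈ (chartAt E c).target) :
    (cotParam c z : T⋆).proj = (chartAt E c).symm z.1 :=
  cotangent_extChartAt_symm_proj (prodDualEquiv_mem_target.2 hz)

theorem cotCoord_cotParam {z : E × E} (hz : z.1 ∈ (chartAt E c).target) :
    cotCoord c (cotParam c z : T⋆) = z := by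
  unfold cotCoord cotParam
  rw [(extChartAt J (⟨c, 0⟩ : T⋆)).right_inv (prodDualEquiv_mem_target.2 hz),
    ContinuousLinearEquiv.symm_apply_apply]

theorem cotParam_cotCoord {q : T⋆} (hq : q.proj ∈ (chartAt E c).source) :
    cotParam c (cotCoord c q) = q := by
  unfold cotCoord cotParam
  rw [ContinuousLinearEquiv.apply_symm_apply, (extChartAt J (⟨c, 0⟩ : T⋆)).left_inv]
  exact mem_cotangent_extChartAt_source.2 hq

theorem contMDiffOn_cotCoord :
    ContMDiffOn J 𝓘(ℝ, E × E) ∞ (cotCoord c) {q : T⋆ | q.proj ∈ (chartAt E c).source} := by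
  have h := contMDiffOn_extChartAt (I := J) (n := ∞) (x := (⟨c, 0⟩ : T⋆))
  have h2 : ContMDiff 𝓘(ℝ, E × (E →L[ℝ] ℝ)) 𝓘(ℝ, E × E) ∞ (prodDualEquiv E).symm :=
    (prodDualEquiv E).symm.contDiff.contMDiff
  refine (h2.comp_contMDiffOn h).mono fun q hq => ?_
  rw [← extChartAt_source J]
  exact mem_cotangent_extChartAt_source.2 hq

theorem contMDiffOn_cotParam :
    ContMDiffOn 𝓘(ℝ, E × E) J ∞ (cotParam c : E × E → T⋆) ((chartAt E c).target ×ˢ univ) := by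
  have h := contMDiffOn_extChartAt_symm (I := J) (n := ∞) (⟨c, 0⟩ : T⋆)
  have h2 : ContMDiff 𝓘(ℝ, E × E) 𝓘(ℝ, E × (E →L[ℝ] ℝ)) ∞ (prodDualEquiv E) :=
    (prodDualEquiv E).contDiff.contMDiff
  exact h.comp h2.contMDiffOn fun z hz => prodDualEquiv_mem_target.2 hz.1

theorem contDiffOn_comp_cotParam {f : T⋆ → ℝ} (hf : ContMDiff J 𝓘(ℝ, ℝ) ∞ f) :
    ContDiffOn ℝ ∞ (f ∘ cotParam c) ((chartAt E c).target ×ˢ univ) :=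
  contMDiffOn_iff_contDiffOn.1 (hf.comp_contMDiffOn contMDiffOn_cotParam)

theorem derivEqTaut_cotParam_iff {f : T⋆ → ℝ} (hf : ContMDiff J 𝓘(ℝ, ℝ) ∞ f) {z : E × E}
    (hz : z.1 ∈ (chartAt E c).target) :
    DerivEqTaut f (cotParam c z) ↔ fderiv ℝ (f ∘ cotParam c) z = modelTaut z := by
  have hz' := prodDualEquiv_mem_target.2 hz
  unfold cotParam
  rw [derivEqTaut_symm_iff hf hz']
  have h1 : (f ∘ fun z => (extChartAt J (⟨c, 0⟩ : T⋆)).symm (prodDualEquiv E z)) =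
    (f ∘ (extChartAt J (⟨c, 0⟩ : T⋆)).symm) ∘ prodDualEquiv E := rfl
  rw [h1, ContinuousLinearEquiv.comp_right_fderiv, (prodDualEquiv E).surjective.forall,
    ContinuousLinearMap.ext_iff]
  exact forall_congr' fun h => Iff.rfl

theorem derivEqTaut_iff {f : T⋆ → ℝ} (hf : ContMDiff J 𝓘(ℝ, ℝ) ∞ f) {q : T⋆}
    (hq : q.proj ∈ (chartAt E c).source) :
    DerivEqTaut f q ↔ fderiv ℝ (f ∘ cotParam c) (cotCoord c q) = modelTaut (cotCoord c q) := by
  rw [← derivEqTaut_cotParam_iff hf, cotParam_cotCoord hq]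
  rw [cotCoord_fst]
  exact (chartAt E c).map_source hq

theorem isClosed_derivEqTaut {f : T⋆ → ℝ} (hf : ContMDiff J 𝓘(ℝ, ℝ) ∞ f) :
    IsClosed {q | DerivEqTaut f q} := by
  rw [← isOpen_compl_iff, isOpen_iff_mem_nhds]
  intro q hq
  have hqs : q.proj ∈ (chartAt E q.proj).source := mem_chart_source E q.proj
  have hU : {q' : T⋆ | q'.proj ∈ (chartAt E q.proj).source} ∈ 𝓝 q :=
    isOpen_proj_source.mem_nhds hqs
  have hz : cotCoord q.proj q ∈ (chartAt E q.proj).target ×ˢ (univ : Set E) :=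
    ⟨by rw [cotCoord_fst]; exact (chartAt E q.proj).map_source hqs, mem_univ _⟩
  have hW : IsOpen ((chartAt E q.proj).target ×ˢ (univ : Set E)) :=
    (chartAt E q.proj).open_target.prod isOpen_univ
  have h1 := (continuousOn_fderiv_sub_modelTaut hW
    (contDiffOn_comp_cotParam (c := q.proj) hf)).continuousAt (hW.mem_nhds hz)
  have h2 : ContinuousAt (cotCoord q.proj) q := contMDiffOn_cotCoord.continuousOn.continuousAt hU
  have h3 := ContinuousAt.comp (f := cotCoord q.proj) h1 h2
  have h4 :
      fderiv ℝ (f ∘ cotParam q.proj) (cotCoord q.proj q) - modelTaut (cotCoord q.proj q) ≠ 0 :=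
    sub_ne_zero.2 fun h => hq ((derivEqTaut_iff hf hqs).2 h)
  filter_upwards [h3.eventually_ne h4, hU] with q' hq' hq's h
  exact hq' (sub_eq_zero.2 ((derivEqTaut_iff hf hq's).1 h))

variable [T2Space N]

/-- A function on a chart domain which agrees with `f` off a compact subset of the base can be
glued with `f`. -/
theorem exists_glue {f : T⋆ → ℝ} (hf : ContMDiff J 𝓘(ℝ, ℝ) ∞ f) {D : Set E} (hD : IsCompact D)
    (hDU : D ⊆ (chartAt E c).target) {g : E × E → ℝ}
    (hg : ContDiffOn ℝ ∞ g ((chartAt E c).target ×ˢ univ))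
    (hgf : ∀ z : E × E, z.1 ∈ (chartAt E c).target → z.1 ∉ D → g z = f (cotParam c z)) :
    ∃ f' : T⋆ → ℝ, ContMDiff J 𝓘(ℝ, ℝ) ∞ f' ∧
      (∀ z ∈ (chartAt E c).target ×ˢ univ, (f' ∘ cotParam c) z = g z) ∧
      ∀ q : T⋆, q.proj ∉ (chartAt E c).symm '' D → f' =ᶠ[𝓝 q] f := by
  classical
  let f' : T⋆ → ℝ := fun q => if q.proj ∈ (chartAt E c).source then g (cotCoord c q) else f q
  have hout : ∀ q : T⋆, q.proj ∉ (chartAt E c).symm '' D → f' q = f q := by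
    intro q hq
    by_cases hqs : q.proj ∈ (chartAt E c).source
    · have : (cotCoord c q).1 = chartAt E c q.proj := cotCoord_fst q
      simp only [f', hqs, if_true]
      rw [hgf, cotParam_cotCoord hqs]
      · rw [this]; exact (chartAt E c).map_source hqs
      · rw [this]; exact fun h => hq (mem_symm_image_of_chart_mem hqs h)
    · simp only [f', hqs, if_false]
  have hout' : ∀ q : T⋆, q.proj ∉ (chartAt E c).symm '' D → f' =ᶠ[𝓝 q] f := by
    intro q hq
    -- Here the Hausdorff property enters: the compact image is closed, so the equality with `f`
    -- holds on an open set.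
    have hcl : IsClosed ((chartAt E c).symm '' D) := (isCompact_chart_symm_image hD hDU).isClosed
    filter_upwards [(hcl.isOpen_compl.preimage (FiberBundle.continuous_proj _ _)).mem_nhds hq]
      with q' hq' using hout q' hq'
  refine ⟨f', fun q => ?_, fun z hz => ?_, hout'⟩
  · by_cases hq : q.proj ∈ (chartAt E c).symm '' D
    · have hqs := (chart_mem_of_mem_symm_image hDU hq).1
      have hU : {q' : T⋆ | q'.proj ∈ (chartAt E c).source} ∈ 𝓝 q := isOpen_proj_source.mem_nhds hqs
      have h1 : ContMDiffOn J 𝓘(ℝ, ℝ) ∞ (g ∘ cotCoord c)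
          {q' : T⋆ | q'.proj ∈ (chartAt E c).source} :=
        hg.contMDiffOn.comp contMDiffOn_cotCoord fun q' hq' =>
          ⟨by rw [cotCoord_fst]; exact (chartAt E c).map_source hq', mem_univ _⟩
      refine (h1.contMDiffAt hU).congr_of_eventuallyEq ?_
      filter_upwards [hU] with q' hq'
      exact if_pos hq'
    · exact hf.contMDiffAt.congr_of_eventuallyEq (hout' q hq)
  · have h1 : (cotParam c z : T⋆).proj ∈ (chartAt E c).source := by
      rw [cotParam_proj hz.1]
      exact (chartAt E c).map_target hz.1
    simp only [f', Function.comp_apply, h1, if_true, cotCoord_cotParam hz.1]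

end CotangentInner

/-! ### Treating one coordinate ball -/

section AdmissiblePerturbation

open Filter Topology Set

variable {E : Type*} [NormedAddCommGroup E] [InnerProductSpace ℝ E]
  {N : Type*} [TopologicalSpace N] [ChartedSpace E N] [IsManifold 𝓘(ℝ, E) ∞ N]

local notation "J" => ModelWithCorners.prod 𝓘(ℝ, E) 𝓘(ℝ, E →L[ℝ] ℝ)

local notation "T⋆" => CotangentBundle 𝓘(ℝ, E) N

/-- A smooth function on `T*N` is admissible if the points at which its differential agrees with
the tautological form make up a set which is proper over `N`. -/
structure IsAdmissible (f : CotangentBundle 𝓘(ℝ, E) N → ℝ) : Prop where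
  contMDiff : ContMDiff J 𝓘(ℝ, ℝ) ∞ f
  isCompact : ∀ L : Set N, IsCompact L → IsCompact ({q : T⋆ | q.proj ∈ L ∧ DerivEqTaut f q})

theorem isAdmissible_zero : IsAdmissible (fun _ : T⋆ => (0 : ℝ)) where
  contMDiff := contMDiff_const
  isCompact L hL := by
    have h1 : Continuous (Bundle.zeroSection (E →L[ℝ] ℝ)
        (fun x : N => TangentSpace 𝓘(ℝ, E) x →L[ℝ] ℝ)) :=
      (Bundle.contMDiff_zeroSection ℝ (n := ∞) (IB := 𝓘(ℝ, E)) _).continuous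
    convert hL.image h1 using 1
    ext q
    simp only [derivEqTaut_zero_iff, mem_image]
    constructor
    · rintro ⟨h2, h3⟩
      refine ⟨q.proj, h2, ?_⟩
      rw [Bundle.zeroSection, ← h3]
    · rintro ⟨x, hx, rfl⟩
      exact ⟨hx, rfl⟩

variable [CompleteSpace E] {c : N}

theorem fderiv_comp_cotParam_eq {f : T⋆ → ℝ} {g : E × E → ℝ}
    (hfg : ∀ z ∈ (chartAt E c).target ×ˢ univ, (f ∘ cotParam c) z = g z) {z : E × E}
    (hz : z.1 ∈ (chartAt E c).target) : fderiv ℝ (f ∘ cotParam c) z = fderiv ℝ g z := by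
  refine Filter.EventuallyEq.fderiv_eq ?_
  filter_upwards [((chartAt E c).open_target.prod isOpen_univ).mem_nhds
    (show z ∈ (chartAt E c).target ×ˢ (univ : Set E) from ⟨hz, mem_univ _⟩)] with w hw
  exact hfg w hw

variable [FiniteDimensional ℝ E]


/-- Properness over `N` confines the coincidences over a closed coordinate ball to a compact set of
coordinates. This supplies the covector bound `R` required by the model lemmas. -/
theorem IsAdmissible.exists_bound {f : T⋆ → ℝ} (hf : IsAdmissible f) {x₀ : E} {s : ℝ}
    (hsU : Metric.closedBall x₀ s ⊆ (chartAt E c).target) :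
    IsCompact (cotCoord c '' {q : T⋆ | q.proj ∈ (chartAt E c).symm '' Metric.closedBall x₀ s ∧
      DerivEqTaut f q}) ∧
    ∀ z : E × E, ‖z.1 - x₀‖ ≤ s → fderiv ℝ (f ∘ cotParam c) z = modelTaut z →
      z ∈ cotCoord c '' {q : T⋆ | q.proj ∈ (chartAt E c).symm '' Metric.closedBall x₀ s ∧
        DerivEqTaut f q} := by
  constructor
  · refine (hf.isCompact _ (isCompact_chart_symm_image (isCompact_closedBall _ _)
      hsU)).image_of_continuousOn ?_
    exact contMDiffOn_cotCoord.continuousOn.mono fun q hq =>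
      (chart_mem_of_mem_symm_image hsU hq.1).1
  · intro z hz hb
    have hzU : z.1 ∈ (chartAt E c).target := hsU (mem_closedBall_iff_norm.2 hz)
    refine ⟨cotParam c z, ⟨?_, (derivEqTaut_cotParam_iff hf.contMDiff hzU).2 hb⟩,
      cotCoord_cotParam hzU⟩
    rw [cotParam_proj hzU]
    exact ⟨z.1, mem_closedBall_iff_norm.2 hz, rfl⟩

variable [T2Space N]

/-- An admissible function can be perturbed so that there is no coincidence over the boundary of a
coordinate ball. -/
theorem IsAdmissible.exists_perturbation {f : T⋆ → ℝ} (hf : IsAdmissible f) {x₀ : E} {r s : ℝ}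
    (hr : 0 < r) (hrs : r < s) (hsU : Metric.closedBall x₀ s ⊆ (chartAt E c).target)
    {A : Set N} (hA : IsCompact A) (hAf : ∀ q : T⋆, q.proj ∈ A → ¬ DerivEqTaut f q) :
    ∃ f' : T⋆ → ℝ, IsAdmissible f' ∧
      (∀ q : T⋆, q.proj ∉ (chartAt E c).symm '' Metric.closedBall x₀ s → f' q = f q) ∧
      (∀ q : T⋆, q.proj ∈ A → ¬ DerivEqTaut f' q) ∧
      ∀ q : T⋆, q.proj ∈ (chartAt E c).symm '' Metric.sphere x₀ r → ¬ DerivEqTaut f' q := by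
  obtain ⟨hZ, hZ'⟩ := hf.exists_bound hsU
  obtain ⟨R, hR⟩ := hZ.isBounded.exists_norm_le
  let L : Set N := (chartAt E c).symm '' Metric.closedBall x₀ s
  have hL : IsCompact L := isCompact_chart_symm_image (isCompact_closedBall _ _) hsU
  have hLs : ∀ x ∈ L, x ∈ (chartAt E c).source ∧ chartAt E c x ∈ Metric.closedBall x₀ s :=
    fun x hx => chart_mem_of_mem_symm_image hsU hx
  -- Only the part of `A` under the larger ball can be affected, and it is compact in the chart.
  let A' : Set E := chartAt E c '' (A ∩ L)
  have hA' : IsClosed A' := ((hA.inter_right hL.isClosed).image_of_continuousOn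
    ((chartAt E c).continuousOn.mono fun x hx => (hLs x hx.2).1)).isClosed
  have hA'g : ∀ z : E × E, z.1 ∈ A' → fderiv ℝ (f ∘ cotParam c) z ≠ modelTaut z := by
    rintro z ⟨x, hx, hxz⟩ h
    have hzU : z.1 ∈ (chartAt E c).target := by
      rw [← hxz]; exact (chartAt E c).map_source (hLs x hx.2).1
    refine hAf (cotParam c z) ?_ ((derivEqTaut_cotParam_iff hf.contMDiff hzU).2 h)
    rw [cotParam_proj hzU, ← hxz, (chartAt E c).left_inv (hLs x hx.2).1]
    exact hx.1
  obtain ⟨g, R', hg, hgf, hgr, hgA⟩ := _root_.exists_perturbation (chartAt E c).open_target hr hrs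
    hsU (contDiffOn_comp_cotParam hf.contMDiff)
    (fun z hz hb => (norm_snd_le z).trans (hR z (hZ' z hz hb))) hA' hA'g
  obtain ⟨f', hf', hf'g, hf'f⟩ := exists_glue hf.contMDiff (isCompact_closedBall x₀ s) hsU hg
    (fun z _ hz => hgf z fun h => hz h.1)
  have hiff : ∀ q : T⋆, q.proj ∈ (chartAt E c).source →
      (DerivEqTaut f' q ↔ fderiv ℝ g (cotCoord c q) = modelTaut (cotCoord c q)) := by
    intro q hq
    rw [derivEqTaut_iff hf' hq, fderiv_comp_cotParam_eq hf'g]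
    rw [cotCoord_fst]
    exact (chartAt E c).map_source hq
  refine ⟨f', ⟨hf', fun K hK => ?_⟩, fun q hq => (hf'f q hq).self_of_nhds, fun q hq => ?_,
    fun q hq => ?_⟩
  · let Q : Set (E × E) := Metric.closedBall x₀ s ×ˢ Metric.closedBall 0 R'
    have hQ : IsCompact Q := (isCompact_closedBall _ _).prod (isCompact_closedBall _ _)
    have hQ' : IsCompact (cotParam c '' Q : Set T⋆) := hQ.image_of_continuousOn
      (contMDiffOn_cotParam.continuousOn.mono (prod_mono hsU (subset_univ _)))
    refine ((hf.isCompact K hK).union hQ').of_isClosed_subset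
      ((hK.isClosed.preimage (FiberBundle.continuous_proj _ _)).inter
        (isClosed_derivEqTaut hf')) ?_
    rintro q ⟨hqK, hq⟩
    -- A coincidence of `f'` either lies in the compact region where the function was changed or was
    -- already one of `f`.
    by_cases hqL : q.proj ∈ L
    · by_cases hqQ : cotCoord c q ∈ Q
      · exact Or.inr ⟨_, hqQ, cotParam_cotCoord (hLs _ hqL).1⟩
      · refine Or.inl ⟨hqK, ?_⟩
        rw [derivEqTaut_iff hf.contMDiff (hLs _ hqL).1]
        rw [← (hiff q (hLs _ hqL).1).1 hq]
        refine Filter.EventuallyEq.fderiv_eq ?_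
        filter_upwards [hQ.isClosed.isOpen_compl.mem_nhds hqQ] with w hw
        exact (hgf w hw).symm
    · exact Or.inl ⟨hqK, (DerivEqTaut.congr (hf'f q hqL)).1 hq⟩
  · by_cases hqL : q.proj ∈ L
    · rw [hiff q (hLs _ hqL).1]
      refine hgA _ ?_
      rw [cotCoord_fst]
      exact ⟨_, ⟨hq, hqL⟩, rfl⟩
    · rw [DerivEqTaut.congr (hf'f q hqL)]
      exact hAf q hq
  · obtain ⟨h1, h2⟩ := chart_mem_of_mem_symm_image ((Metric.sphere_subset_closedBall.trans
      (Metric.closedBall_subset_closedBall hrs.le)).trans hsU) hq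
    rw [hiff q h1]
    refine hgr _ ?_
    rw [cotCoord_fst]
    exact mem_sphere_iff_norm.1 h2

/-- If there is no coincidence over the boundary of a coordinate ball, then the coincidences over
the ball can be removed. -/
theorem IsAdmissible.exists_removal [Nontrivial E] {f : T⋆ → ℝ} (hf : IsAdmissible f) {x₀ : E}
    {r s : ℝ} (hr : 0 < r) (hrs : r < s)
    (hsU : Metric.closedBall x₀ s ⊆ (chartAt E c).target)
    (hfr : ∀ q : T⋆, q.proj ∈ (chartAt E c).symm '' Metric.sphere x₀ r → ¬ DerivEqTaut f q) :
    ∃ f' : T⋆ → ℝ, IsAdmissible f' ∧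
      (∀ q : T⋆, q.proj ∉ (chartAt E c).symm '' Metric.closedBall x₀ s → f' q = f q) ∧
      (∀ q : T⋆, DerivEqTaut f' q → DerivEqTaut f q) ∧
      ∀ q : T⋆, q.proj ∈ (chartAt E c).symm '' Metric.closedBall x₀ r → ¬ DerivEqTaut f' q := by
  obtain ⟨hZ, hZ'⟩ := hf.exists_bound hsU
  set Z := cotCoord c '' {q : T⋆ | q.proj ∈ (chartAt E c).symm '' Metric.closedBall x₀ s ∧
      DerivEqTaut f q} with hZdef
  obtain ⟨R, hR⟩ := hZ.isBounded.exists_norm_le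
  have hd : Continuous fun z : E × E => ‖z.1 - x₀‖ := by fun_prop
  have hrZ : r ∈ ((fun z : E × E => ‖z.1 - x₀‖) '' Z)ᶜ := by
    rintro ⟨_, ⟨q, ⟨hq, hqf⟩, rfl⟩, h⟩
    have h1 := chart_mem_of_mem_symm_image hsU hq
    refine hfr q (mem_symm_image_of_chart_mem h1.1 ?_) hqf
    rw [mem_sphere_iff_norm, ← cotCoord_fst]
    exact h
  obtain ⟨ε, hε, hεZ⟩ := Metric.isOpen_iff.1 (hZ.image hd).isClosed.isOpen_compl r hrZ
  -- No coincidence lies at distance within `ε` of `r`. Thus those over the `t`-ball lie over the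
  -- `ρ`-ball; `r / 2` keeps `ρ` nonnegative and `s` keeps the `t`-ball in the chart.
  let ρ := max (r - ε / 2) (r / 2)
  let t := min (r + ε / 2) s
  have hρr : ρ < r := max_lt (by linarith) (by linarith)
  have hrt : r < t := lt_min (by linarith) hrs
  have hts : t ≤ s := min_le_right _ _
  have htU : Metric.closedBall x₀ t ⊆ (chartAt E c).target :=
    (Metric.closedBall_subset_closedBall hts).trans hsU
  obtain ⟨g, r', hr't, hg, hgf, hgb⟩ := _root_.exists_removal (chartAt E c).open_target
    ((half_pos hr).le.trans (le_max_right _ _) : 0 ≤ ρ) (hρr.trans hrt) htU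
    (contDiffOn_comp_cotParam hf.contMDiff) (R := R) fun z hz hb => by
      have hzZ := hZ' z (hz.trans hts) hb
      refine ⟨?_, (norm_snd_le z).trans (hR z hzZ)⟩
      by_contra! h
      refine hεZ ?_ ⟨z, hzZ, rfl⟩
      rw [Metric.mem_ball, Real.dist_eq, abs_lt]
      have h1 : r - ε / 2 ≤ ρ := le_max_left _ _
      have h2 : t ≤ r + ε / 2 := min_le_left _ _
      exact ⟨by linarith, by linarith⟩
  have hr'U : Metric.closedBall x₀ r' ⊆ (chartAt E c).target :=
    (Metric.closedBall_subset_closedBall hr't.le).trans htU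
  obtain ⟨f', hf', hf'g, hf'f⟩ := exists_glue hf.contMDiff (isCompact_closedBall x₀ r') hr'U hg
    (fun z _ hz => hgf z (by rwa [mem_closedBall_iff_norm, not_le] at hz))
  have hball : ∀ q : T⋆, q.proj ∈ (chartAt E c).symm '' Metric.closedBall x₀ t →
      ¬ DerivEqTaut f' q := by
    intro q hq
    obtain ⟨h1, h2⟩ := chart_mem_of_mem_symm_image htU hq
    have h3 := cotCoord_fst (c := c) q
    rw [derivEqTaut_iff hf' h1, fderiv_comp_cotParam_eq hf'g]
    · refine hgb _ ?_
      rw [h3]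
      exact mem_closedBall_iff_norm.1 h2
    · rw [h3]
      exact (chartAt E c).map_source h1
  have hsub : ∀ q : T⋆, DerivEqTaut f' q → DerivEqTaut f q := by
    intro q hq
    refine (DerivEqTaut.congr (hf'f q fun h => hball q ?_ hq)).1 hq
    exact image_mono (Metric.closedBall_subset_closedBall hr't.le) h
  refine ⟨f', ⟨hf', fun K hK => ?_⟩, fun q hq => (hf'f q fun h => hq ?_).self_of_nhds, hsub,
    fun q hq => hball q ?_⟩
  · exact (hf.isCompact K hK).of_isClosed_subset
      ((hK.isClosed.preimage (FiberBundle.continuous_proj _ _)).inter (isClosed_derivEqTaut hf'))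
      fun q hq => ⟨hq.1, hsub q hq.2⟩
  · exact image_mono (Metric.closedBall_subset_closedBall (hr't.le.trans hts)) h
  · exact image_mono (Metric.closedBall_subset_closedBall hrt.le) hq

/-- All coincidences over a coordinate ball can be removed without creating new ones over a given
compact set. -/
theorem IsAdmissible.exists_step [Nontrivial E] {f : T⋆ → ℝ} (hf : IsAdmissible f) {x₀ : E}
    {r s : ℝ} (hr : 0 < r) (hrs : r < s)
    (hsU : Metric.closedBall x₀ s ⊆ (chartAt E c).target)
    {A : Set N} (hA : IsCompact A) (hAf : ∀ q : T⋆, q.proj ∈ A → ¬ DerivEqTaut f q) :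
    ∃ f' : T⋆ → ℝ, IsAdmissible f' ∧
      (∀ q : T⋆, q.proj ∉ (chartAt E c).symm '' Metric.closedBall x₀ s → f' q = f q) ∧
      ∀ q : T⋆, q.proj ∈ A ∪ (chartAt E c).symm '' Metric.closedBall x₀ r →
        ¬ DerivEqTaut f' q := by
  -- The sphere to be cleared has an intermediate radius: `s` leaves room for the changes, and the
  -- `t`-ball covers the `r`-ball. The removal creates no coincidences, so `A` stays clear.
  obtain ⟨t, hrt, hts⟩ := exists_between hrs
  obtain ⟨f₁, hf₁, h1, h2, h3⟩ := hf.exists_perturbation (hr.trans hrt) hts hsU hA hAf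
  obtain ⟨f₂, hf₂, k1, k2, k3⟩ := hf₁.exists_removal (hr.trans hrt) hts hsU h3
  refine ⟨f₂, hf₂, fun q hq => (k1 q hq).trans (h1 q hq), ?_⟩
  rintro q (hq | hq) h
  · exact h2 q hq (k2 q h)
  · exact k3 q (image_mono (Metric.closedBall_subset_closedBall hrt.le) hq) h

end AdmissiblePerturbation

/-! ### Induction over a locally finite cover -/

section GlobalFunction

open Filter Topology Set

universe u v

variable {E : Type v} [NormedAddCommGroup E]

/-- A manifold is covered by a countable locally finite family of coordinate balls, which remains
locally finite when the balls are replaced by slightly larger ones. -/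
theorem exists_locallyFinite_coordinate_balls
    [NormedSpace ℝ E] [FiniteDimensional ℝ E] (N : Type u)
    [TopologicalSpace N] [ChartedSpace E N] [T2Space N] [SecondCountableTopology N]
    [IsManifold 𝓘(ℝ, E) ∞ N] :
    ∃ (ι : Type u) (_ : Encodable ι) (c : ι → N) (x₀ : ι → E) (r s : ι → ℝ),
      (∀ i, 0 < r i) ∧ (∀ i, r i < s i) ∧
      (∀ i, Metric.closedBall (x₀ i) (s i) ⊆ (chartAt E (c i)).target) ∧
      (LocallyFinite fun i => (chartAt E (c i)).symm '' Metric.closedBall (x₀ i) (s i)) ∧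
      ∀ x, ∃ i, x ∈ (chartAt E (c i)).symm '' Metric.closedBall (x₀ i) (r i) := by
  have : LocallyCompactSpace N := ChartedSpace.locallyCompactSpace E N
  obtain ⟨ι, f, -⟩ := SmoothBumpCovering.exists_isSubordinate 𝓘(ℝ, E)
    (isClosed_univ (X := N)) (U := fun _ => univ) fun x _ => univ_mem
  have hcov : ⋃ i, Function.support (f i) = univ :=
    eq_univ_of_forall fun x => mem_iUnion.2 ⟨_, f.mem_support_ind x (mem_univ x)⟩
  -- Shrinking the supports to closed sets that still cover gives radii `r i` strictly below the
  -- outer ones, with room for `s i` in between.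
  obtain ⟨V, hVcov, hVc, hV⟩ := exists_iUnion_eq_closed_subset
    (fun i => (f i).isOpen_support) (fun x => f.locallyFinite.point_finite x) hcov
  choose r hr hrV using fun i => (f i).exists_r_pos_lt_subset_ball (hVc i) (hV i)
  choose s hrs hs using fun i => exists_between (hr i).2
  have htarget : ∀ i, Metric.closedBall (extChartAt 𝓘(ℝ, E) (f.c i) (f.c i)) (f i).rOut ⊆
      (chartAt E (f.c i)).target := fun i => by simpa using (f i).closedBall_subset
  have hsup : ∀ i, (chartAt E (f.c i)).symm ''
      Metric.closedBall (extChartAt 𝓘(ℝ, E) (f.c i) (f.c i)) (s i) ⊆ Function.support (f i) := by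
    intro i x hx
    obtain ⟨h1, h2⟩ := chart_mem_of_mem_symm_image
      ((Metric.closedBall_subset_closedBall (hs i).le).trans (htarget i)) hx
    rw [SmoothBumpFunction.support_eq_inter_preimage]
    exact ⟨h1, Metric.closedBall_subset_ball (hs i) (by simpa using h2)⟩
  have hlf := f.locallyFinite.subset hsup
  have henc : Encodable ι := hlf.encodable fun i =>
    (Metric.nonempty_closedBall.2 ((hr i).1.trans (hrs i)).le).image _
  refine ⟨ι, henc, f.c, fun i => extChartAt 𝓘(ℝ, E) (f.c i) (f.c i), r, s, fun i => (hr i).1, hrs,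
    fun i => (Metric.closedBall_subset_closedBall (hs i).le).trans (htarget i), hlf, fun x => ?_⟩
  obtain ⟨i, hi⟩ := mem_iUnion.1 (hVcov ▸ mem_univ x : x ∈ ⋃ i, V i)
  have h := hrV i hi
  exact ⟨i, mem_symm_image_of_chart_mem h.1 (Metric.ball_subset_closedBall (by simpa using h.2))⟩

variable [InnerProductSpace ℝ E] [CompleteSpace E] [FiniteDimensional ℝ E] [Nontrivial E]
  {N : Type u} [TopologicalSpace N] [ChartedSpace E N] [IsManifold 𝓘(ℝ, E) ∞ N] [T2Space N]
  [SecondCountableTopology N]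

local notation "J" => ModelWithCorners.prod 𝓘(ℝ, E) 𝓘(ℝ, E →L[ℝ] ℝ)

local notation "T⋆" => CotangentBundle 𝓘(ℝ, E) N

/-- There is a smooth function on `T*N` whose differential agrees nowhere with the tautological
form. -/
theorem exists_forall_not_derivEqTaut :
    ∃ f : CotangentBundle 𝓘(ℝ, E) N → ℝ, ContMDiff J 𝓘(ℝ, ℝ) ∞ f ∧ ∀ q, ¬ DerivEqTaut f q := by
  obtain ⟨ι, henc, c, x₀, r, s, hr, hrs, hsU, hlf, hcov⟩ := exists_locallyFinite_coordinate_balls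
    (E := E) N
  let D : ι → Set N := fun i => (chartAt E (c i)).symm '' Metric.closedBall (x₀ i) (r i)
  let S : ι → Set N := fun i => (chartAt E (c i)).symm '' Metric.closedBall (x₀ i) (s i)
  have hDc : ∀ i, IsCompact (D i) := fun i => isCompact_chart_symm_image (isCompact_closedBall _ _)
    ((Metric.closedBall_subset_closedBall (hrs i).le).trans (hsU i))
  let A : ℕ → Set N := fun k => ⋃ i ∈ {i : ι | Encodable.encode i < k}, D i
  have hAc : ∀ k, IsCompact (A k) := fun k =>
    ((finite_lt_nat k).preimage Encodable.encode_injective.injOn).isCompact_biUnion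
      fun i _ => hDc i
  let P : ℕ → (T⋆ → ℝ) → Prop := fun k f =>
    IsAdmissible f ∧ ∀ q : T⋆, q.proj ∈ A k → ¬ DerivEqTaut f q
  have hstep : ∀ (k : ℕ) (f : {f // P k f}), ∃ f' : {f // P (k + 1) f},
      ∀ q : T⋆, (∀ i, Encodable.encode i = k → q.proj ∉ S i) → f'.1 q = f.1 q := by
    rintro k ⟨f, hf, hfA⟩
    by_cases hk : ∃ i : ι, Encodable.encode i = k
    · obtain ⟨i, hi⟩ := hk
      obtain ⟨f', hf', h1, h2⟩ := hf.exists_step (hr i) (hrs i) (hsU i) (hAc k) hfA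
      refine ⟨⟨f', hf', fun q hq => h2 q ?_⟩, fun q hq => h1 q (hq i hi)⟩
      obtain ⟨j, hj, hjq⟩ := mem_iUnion₂.1 hq
      rcases Nat.lt_succ_iff_lt_or_eq.1 (show Encodable.encode j < k + 1 from hj) with hjk | hjk
      · exact Or.inl (mem_iUnion₂.2 ⟨j, hjk, hjq⟩)
      · rw [← hi] at hjk
        rw [Encodable.encode_injective hjk] at hjq
        exact Or.inr hjq
    -- If `k` encodes no index, then `A (k + 1)` contains nothing beyond `A k`, and `f` is kept.
    · refine ⟨⟨f, hf, fun q hq => hfA q ?_⟩, fun q _ => rfl⟩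
      obtain ⟨j, hj, hjq⟩ := mem_iUnion₂.1 hq
      rcases Nat.lt_succ_iff_lt_or_eq.1 (show Encodable.encode j < k + 1 from hj) with hjk | hjk
      · exact mem_iUnion₂.2 ⟨j, hjk, hjq⟩
      · exact absurd ⟨j, hjk⟩ hk
  choose next hnext using hstep
  let F : ∀ k, {f // P k f} := fun k => Nat.rec (motive := fun k => {f // P k f})
    ⟨fun _ => 0, isAdmissible_zero, fun q hq => by simp [A] at hq⟩ (fun k f => next k f) k
  have hF : ∀ k q, (∀ i, Encodable.encode i = k → (q : T⋆).proj ∉ S i) →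
      (F (k + 1)).1 q = (F k).1 q := fun k q hq => hnext k (F k) q hq
  obtain ⟨G, hG⟩ := exists_eventuallyEq_of_locally_eventually_const (fun k => (F k).1) fun p => by
    obtain ⟨U, hU, hfin⟩ := hlf p.proj
    obtain ⟨k₀, hk₀⟩ := (hfin.image Encodable.encode).bddAbove
    refine ⟨Bundle.TotalSpace.proj ⁻¹' U,
      (FiberBundle.continuous_proj _ _).continuousAt.preimage_mem_nhds hU, k₀ + 1,
      fun k hk q hq => hF k q fun i hi hqi => ?_⟩
    have := hk₀ ⟨i, ⟨q.proj, hqi, hq⟩, rfl⟩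
    omega
  refine ⟨G, fun q => ?_, fun q hq => ?_⟩
  · obtain ⟨k, hk⟩ := hG q
    exact ((F k).2.1.contMDiff q).congr_of_eventuallyEq (hk k le_rfl)
  · obtain ⟨k, hk⟩ := hG q
    obtain ⟨i, hi⟩ := hcov q.proj
    -- This stage is late enough to agree with `G` near `q` and to have treated the ball `i`.
    refine (F (max k (Encodable.encode i + 1))).2.2 q ?_
      ((DerivEqTaut.congr (hk _ (le_max_left _ _))).1 hq)
    exact mem_iUnion₂.2 ⟨i, Nat.lt_of_succ_le (le_max_right _ _), hi⟩

end GlobalFunction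

/-! ### Exterior calculus of 1-forms and the constant symplectic form -/

section ModelForms

open Filter Topology Set

variable {V : Type*} [NormedAddCommGroup V] [NormedSpace ℝ V]

/-- A field of linear forms, as a field of alternating `1`-forms. -/
def oneForm (B : V → V →L[ℝ] ℝ) (y : V) : V [⋀^Fin 1]→L[ℝ] ℝ :=
  ContinuousAlternatingMap.ofSubsingleton ℝ V ℝ (0 : Fin 1) (B y)

@[simp]
theorem oneForm_apply (B : V → V →L[ℝ] ℝ) (y : V) (v : Fin 1 → V) : oneForm B y v = B y (v 0) :=
  rfl

theorem ContDiffOn.oneForm {B : V → V →L[ℝ] ℝ} {s : Set V} {k : WithTop ℕ∞}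
    (hB : ContDiffOn ℝ k B s) : ContDiffOn ℝ k (oneForm B) s :=
  (ContinuousAlternatingMap.ofSubsingletonLIE (𝕜 := ℝ) (E := V) (F := ℝ)
    (0 : Fin 1)).toContinuousLinearEquiv.contDiff.comp_contDiffOn hB

theorem ContDiffOn.comp_sharp {B : V → V →L[ℝ] ℝ} {s : Set V} {k : WithTop ℕ∞}
    (hB : ContDiffOn ℝ k B s) (S : (V →L[ℝ] ℝ) →L[ℝ] V) : ContDiffOn ℝ k (fun y => S (B y)) s :=
  S.contDiff.comp_contDiffOn hB

theorem DifferentiableAt.oneForm {B : V → V →L[ℝ] ℝ} {y : V} (hB : DifferentiableAt ℝ B y) :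
    DifferentiableAt ℝ (oneForm B) y :=
  (ContinuousAlternatingMap.ofSubsingletonLIE (𝕜 := ℝ) (E := V) (F := ℝ)
    (0 : Fin 1)).toContinuousLinearEquiv.differentiableAt.comp y hB

theorem ContinuousLinearMap.differentiableAt_oneForm (Θ : V →L[ℝ] V →L[ℝ] ℝ) (y : V) :
    DifferentiableAt ℝ (_root_.oneForm Θ) y :=
  Θ.differentiableAt.oneForm

theorem extDeriv_oneForm {B : V → V →L[ℝ] ℝ} {y : V} (hB : DifferentiableAt ℝ B y)
    (v : Fin 2 → V) :
    extDeriv (oneForm B) y v = fderiv ℝ B y (v 0) (v 1) - fderiv ℝ B y (v 1) (v 0) := by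
  have h : ∀ w : V, fderiv ℝ (fun z => B z w) y = (fderiv ℝ B y).flip w := by
    intro w
    ext u
    rw [fderiv_clm_apply hB (differentiableAt_const w)]
    simp
  rw [extDeriv_apply hB.oneForm, Fin.sum_univ_two]
  simp only [oneForm_apply, h]
  simp [Fin.removeNth, sub_eq_add_neg]

theorem extDeriv_oneForm_clm (Θ : V →L[ℝ] V →L[ℝ] ℝ) (y : V) (v : Fin 2 → V) :
    extDeriv (oneForm Θ) y v = Θ (v 0) (v 1) - Θ (v 1) (v 0) := by
  rw [extDeriv_oneForm Θ.differentiableAt, ContinuousLinearMap.fderiv]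

/-- A nondegenerate bilinear form on a finite-dimensional space identifies it with its dual. -/
theorem exists_sharp [FiniteDimensional ℝ V] (b : V →L[ℝ] V →L[ℝ] ℝ)
    (hb : ∀ h, (∀ k, b h k = 0) → h = 0) :
    ∃ S : (V →L[ℝ] ℝ) →L[ℝ] V, (∀ l k, b (S l) k = l k) ∧
      ∀ l h, (∀ k, b h k = l k) → h = S l := by
  have hinj : Function.Injective b := (injective_iff_map_eq_zero b).2 fun h hh =>
    hb h fun k => by rw [hh]; rfl
  have hfin : Module.finrank ℝ V = Module.finrank ℝ (V →L[ℝ] ℝ) := by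
    rw [← (LinearMap.toContinuousLinearMap (𝕜 := ℝ) (E := V) (F' := ℝ)).finrank_eq]
    exact Subspace.dual_finrank_eq.symm
  let e := (LinearEquiv.ofInjectiveOfFinrankEq b.toLinearMap hinj hfin).toContinuousLinearEquiv
  have hS : ∀ l k, b (e.symm l) k = l k := fun l k =>
    congrArg (fun L => L k) (e.apply_symm_apply l)
  exact ⟨e.symm, hS, fun l h hh => hinj <|
    (ContinuousLinearMap.ext fun k => (hh k).trans (hS l k).symm)⟩

/-- If `S` inverts the contraction with a constant `2`-form `b`, then the Lie derivative of `b`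
along `S ∘ B` is the exterior derivative of `B`. -/
theorem sum_update_fderiv_sharp {b : V [⋀^Fin 2]→L[ℝ] ℝ} {S : (V →L[ℝ] ℝ) →L[ℝ] V}
    (hS : ∀ l k, b ![S l, k] = l k) {B : V → V →L[ℝ] ℝ} {y : V} (hB : DifferentiableAt ℝ B y)
    (v : Fin 2 → V) :
    ∑ i, b (Function.update v i (fderiv ℝ (fun z => S (B z)) y (v i))) =
      extDeriv (oneForm B) y v := by
  have hd : fderiv ℝ (fun z => S (B z)) y = S.comp (fderiv ℝ B y) := by
    have h := fderiv_comp y (S.differentiableAt (x := B y)) hB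
    rwa [S.fderiv] at h
  have h0 : Function.update v 0 (S (fderiv ℝ B y (v 0))) = ![S (fderiv ℝ B y (v 0)), v 1] := by
    ext i; fin_cases i <;> simp
  -- The second slot is swapped with the first so that `hS` applies; the sign of the swap is the
  -- minus sign in the exterior derivative.
  have h1 : Function.update v 1 (S (fderiv ℝ B y (v 1))) =
      ![S (fderiv ℝ B y (v 1)), v 0] ∘ Equiv.swap 0 1 := by
    ext i; fin_cases i <;> simp
  have h2 := b.toAlternatingMap.map_swap ![S (fderiv ℝ B y (v 1)), v 0] (zero_ne_one (α := Fin 2))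
  rw [extDeriv_oneForm hB, Fin.sum_univ_two, hd]
  simp only [ContinuousLinearMap.comp_apply, h0, h1]
  rw [hS]
  change _ + b.toAlternatingMap _ = _
  rw [h2]
  exact congrArg (fun t => _ + -t) (hS _ _)

/-- The exterior derivative of `dg - Θ` is that of `-Θ`. -/
theorem extDeriv_oneForm_fderiv_sub {g : V → ℝ} {y : V} (hg : ContDiffAt ℝ ∞ g y)
    (Θ : V →L[ℝ] V →L[ℝ] ℝ) :
    extDeriv (oneForm fun y => fderiv ℝ g y - Θ y) y = -extDeriv (oneForm Θ) y := by
  have h1 : DifferentiableAt ℝ (fderiv ℝ g) y :=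
    (hg.fderiv_right (m := 1) (by norm_cast)).differentiableAt (by simp)
  have hs : IsSymmSndFDerivAt ℝ g y := hg.isSymmSndFDerivAt (by simpa using ENat.LEInfty.out)
  ext v
  have h2 := extDeriv_oneForm (B := fun y => fderiv ℝ g y - Θ y) (h1.sub Θ.differentiableAt) v
  rw [fderiv_fun_sub h1 Θ.differentiableAt] at h2
  rw [h2]
  change _ = -(extDeriv (oneForm Θ) y v)
  rw [extDeriv_oneForm_clm]
  simp only [ContinuousLinearMap.fderiv, sub_apply]
  -- Symmetry of the second derivative, that is, `d (dg) = 0`.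
  rw [hs.eq (v 0) (v 1)]
  ring

theorem ContDiffOn.fderiv_sub_clm {g : V → ℝ} {s : Set V} (hg : ContDiffOn ℝ ∞ g s) (hs : IsOpen s)
    (Θ : V →L[ℝ] V →L[ℝ] ℝ) : ContDiffOn ℝ ∞ (fun y => fderiv ℝ g y - Θ y) s :=
  (hg.fderiv_of_isOpen hs (by simp)).sub Θ.contDiff.contDiffOn

variable (E : Type*) [NormedAddCommGroup E] [NormedSpace ℝ E]

/-- The tautological form on `E × E*`. -/
def dualTaut : E × (E →L[ℝ] ℝ) →L[ℝ] (E × (E →L[ℝ] ℝ) →L[ℝ] ℝ) :=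
  ((ContinuousLinearMap.compL ℝ (E × (E →L[ℝ] ℝ)) E ℝ).flip
    (ContinuousLinearMap.fst ℝ E (E →L[ℝ] ℝ))).comp (ContinuousLinearMap.snd ℝ E (E →L[ℝ] ℝ))

/-- The canonical symplectic form on `E × E*`. -/
def dualSymplectic : (E × (E →L[ℝ] ℝ)) [⋀^Fin 2]→L[ℝ] ℝ :=
  -extDeriv (oneForm (dualTaut E)) 0

variable {E}

theorem dualSymplectic_apply (v : Fin 2 → E × (E →L[ℝ] ℝ)) :
    dualSymplectic E v = (v 1).2 (v 0).1 - (v 0).2 (v 1).1 := by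
  change -(extDeriv (oneForm (dualTaut E)) 0 v) = _
  rw [extDeriv_oneForm_clm]
  exact neg_sub _ _

theorem extDeriv_dualTaut (y : E × (E →L[ℝ] ℝ)) :
    extDeriv (oneForm (dualTaut E)) y = -dualSymplectic E := by
  ext v
  change _ = -(dualSymplectic E v)
  rw [dualSymplectic_apply, extDeriv_oneForm_clm]
  exact (neg_sub _ _).symm

/-- The symplectic form identifies `E × E*` with its dual. -/
theorem exists_dualSymplectic_sharp [FiniteDimensional ℝ E] :
    ∃ S : (E × (E →L[ℝ] ℝ) →L[ℝ] ℝ) →L[ℝ] E × (E →L[ℝ] ℝ),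
      (∀ l k, dualSymplectic E ![S l, k] = l k) ∧
      ∀ l h, (∀ k, dualSymplectic E ![h, k] = l k) → h = S l := by
  obtain ⟨S, hS, hS'⟩ := exists_sharp ((dualTaut E).flip - dualTaut E) fun h hh => by
    have h0 : ∀ k : E × (E →L[ℝ] ℝ), k.2 h.1 - h.2 k.1 = 0 := hh
    refine Prod.ext ?_ ?_
    · by_contra hne
      obtain ⟨l, hl⟩ := SeparatingDual.exists_ne_zero (R := ℝ) hne
      exact hl (by simpa using h0 (0, l))
    · refine ContinuousLinearMap.ext fun k => ?_
      simpa using h0 (k, 0)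
  refine ⟨S, fun l k => ?_, fun l h hh => hS' l h fun k => ?_⟩
  · rw [dualSymplectic_apply, ← hS l k]
    rfl
  · rw [← hh k, dualSymplectic_apply]
    rfl

end ModelForms

/-! ### The form `df - θ` and its exterior derivative -/

section CotangentForms

open Filter Topology Set

variable {E : Type*} [NormedAddCommGroup E] [NormedSpace ℝ E]
  {N : Type*} [TopologicalSpace N] [ChartedSpace E N] [IsManifold 𝓘(ℝ, E) ∞ N]

local notation "J" => ModelWithCorners.prod 𝓘(ℝ, E) 𝓘(ℝ, E →L[ℝ] ℝ)

local notation "T⋆" => CotangentBundle 𝓘(ℝ, E) N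

theorem tautologicalForm_inChart {p : T⋆} {y : E × (E →L[ℝ] ℝ)}
    (hy : y ∈ (extChartAt J p).target) :
    (tautologicalForm 𝓘(ℝ, E) N).inChart p y = oneForm (dualTaut E) y := by
  unfold FormField.inChart
  rw [ModelWithCorners.range_eq_univ, mfderivWithin_univ]
  ext v
  exact tautologicalLinear_symm hy (v 0)

theorem tautologicalForm_d (p : T⋆) : (tautologicalForm 𝓘(ℝ, E) N).d p =
    (-dualSymplectic E).compContinuousLinearMap
      (mfderiv J 𝓘(ℝ, E × (E →L[ℝ] ℝ)) (extChartAt J p) p) := by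
  unfold FormField.d
  rw [ModelWithCorners.range_eq_univ, extDerivWithin_univ]
  have h : (tautologicalForm 𝓘(ℝ, E) N).inChart p =ᶠ[𝓝 (extChartAt J p p)]
      oneForm (dualTaut E) := by
    filter_upwards [(isOpen_cotangent_extChartAt_target p).mem_nhds (mem_extChartAt_target p)]
      with y hy using tautologicalForm_inChart hy
  rw [h.extDeriv_eq, extDeriv_dualTaut]

theorem canonicalForm_eq (p : T⋆) : canonicalForm 𝓘(ℝ, E) N p =
    (dualSymplectic E).compContinuousLinearMap
      (mfderiv J 𝓘(ℝ, E × (E →L[ℝ] ℝ)) (extChartAt J p) p) := by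
  unfold canonicalForm
  rw [tautologicalForm_d]
  ext v
  exact neg_neg _

/-- The coordinate changes between the canonical coordinates on `T*N` preserve the tautological
form. -/
theorem dualTaut_coordChange {p q : T⋆} {y : E × (E →L[ℝ] ℝ)}
    (hy : y ∈ (extChartAt J p).target) (hyq : (extChartAt J p).symm y ∈ (extChartAt J q).source)
    (h : E × (E →L[ℝ] ℝ)) :
    dualTaut E (extChartAt J q ((extChartAt J p).symm y))
      (fderiv ℝ (extChartAt J q ∘ (extChartAt J p).symm) y h) = dualTaut E y h := by
  have hq := mdifferentiableAt_extChartAt (I := J) (by rwa [extChartAt_source] at hyq)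
  have hyq' := (extChartAt J q).map_source hyq
  have hd := mdifferentiableAt_cotangent_symm hy
  have heq : (extChartAt J q).symm ∘ extChartAt J q ∘ (extChartAt J p).symm =ᶠ[𝓝 y]
      (extChartAt J p).symm := by
    have hc := hd.continuousAt.preimage_mem_nhds ((isOpen_extChartAt_source q).mem_nhds hyq)
    filter_upwards [hc] with w hw
    exact (extChartAt J q).left_inv hw
  have h1 := heq.mfderiv_eq (I := 𝓘(ℝ, E × (E →L[ℝ] ℝ))) (I' := J)
  rw [mfderiv_comp y (mdifferentiableAt_cotangent_symm hyq') (hq.comp y hd),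
    mfderiv_eq_fderiv] at h1
  have h2 := tautologicalLinear_symm hyq'
    (fderiv ℝ (extChartAt J q ∘ (extChartAt J p).symm) y h)
  have h3 := tautologicalLinear_symm hy h
  have h4 := congrArg (fun L => L h) h1
  -- The tangent spaces at propositionally equal points are different types, so the vector is kept
  -- in the common model space.
  have h5 : ∀ {q₁ q₂ : T⋆}, q₁ = q₂ → ∀ v : E × (E →L[ℝ] ℝ),
      tautologicalLinear q₁ v = tautologicalLinear q₂ v := by
    rintro q₁ _ rfl v
    rfl
  exact h2.symm.trans ((h5 ((extChartAt J q).left_inv hyq) _).trans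
    ((congrArg (tautologicalLinear ((extChartAt J p).symm y)) h4).trans h3))

theorem contDiffAt_cotangent_coordChange {p q : T⋆} {y : E × (E →L[ℝ] ℝ)}
    (hy : y ∈ (extChartAt J p).target) (hyq : (extChartAt J p).symm y ∈ (extChartAt J q).source) :
    ContDiffAt ℝ ∞ (extChartAt J q ∘ (extChartAt J p).symm) y := by
  refine contMDiffAt_iff_contDiffAt.1 (ContMDiffAt.comp (I' := J) y ?_ ?_)
  · exact contMDiffAt_extChartAt' (by rwa [extChartAt_source] at hyq)
  · exact (contMDiffOn_extChartAt_symm p).contMDiffAt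
      ((isOpen_cotangent_extChartAt_target p).mem_nhds hy)

/-- Coordinate changes preserve `θ`, and pullback commutes with the exterior derivative. -/
theorem dualSymplectic_coordChange {p q : T⋆} {y : E × (E →L[ℝ] ℝ)}
    (hy : y ∈ (extChartAt J p).target) (hyq : (extChartAt J p).symm y ∈ (extChartAt J q).source) :
    (dualSymplectic E).compContinuousLinearMap
      (fderiv ℝ (extChartAt J q ∘ (extChartAt J p).symm) y) = dualSymplectic E := by
  have hτ := contDiffAt_cotangent_coordChange hy hyq
  have heq : (fun w => (oneForm (dualTaut E)
      ((extChartAt J q ∘ (extChartAt J p).symm) w)).compContinuousLinearMap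
        (fderiv ℝ (extChartAt J q ∘ (extChartAt J p).symm) w)) =ᶠ[𝓝 y] oneForm (dualTaut E) := by
    have hc := (mdifferentiableAt_cotangent_symm hy).continuousAt.preimage_mem_nhds
      ((isOpen_extChartAt_source q).mem_nhds hyq)
    filter_upwards [hc, (isOpen_cotangent_extChartAt_target p).mem_nhds hy] with w hw hw'
    ext v
    exact dualTaut_coordChange hw' hw (v 0)
  have h := extDeriv_pullback (ContinuousLinearMap.differentiableAt_oneForm (dualTaut E) _) hτ
    (by simpa using ENat.LEInfty.out)
  rw [heq.extDeriv_eq, extDeriv_dualTaut, extDeriv_dualTaut] at h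
  ext v
  have h' := congrArg (fun η => η v) h
  exact (neg_injective h').symm

/-- The value of `canonicalForm` at each point is computed in the chart around that very point.
Reading it in one fixed chart inserts a coordinate change that varies with the point, harmless
because it is symplectic. -/
theorem canonicalForm_inChart {p : T⋆} {y : E × (E →L[ℝ] ℝ)}
    (hy : y ∈ (extChartAt J p).target) :
    (canonicalForm 𝓘(ℝ, E) N).inChart p y = dualSymplectic E := by
  have hyq := mem_extChartAt_source (I := J) ((extChartAt J p).symm y)
  refine Eq.trans ?_ (dualSymplectic_coordChange hy hyq)
  unfold FormField.inChart
  rw [ModelWithCorners.range_eq_univ, mfderivWithin_univ, canonicalForm_eq, ← mfderiv_eq_fderiv,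
    mfderiv_comp (I' := J) y (mdifferentiableAt_extChartAt (mem_chart_source _ _))
      (mdifferentiableAt_cotangent_symm hy)]
  rfl

/-- The differential of a function on `T*N` at a point, as a linear form. -/
def cotangentDifferential (f : CotangentBundle 𝓘(ℝ, E) N → ℝ) (q : T⋆) :
    TangentSpace J q →L[ℝ] ℝ :=
  mfderiv J 𝓘(ℝ, ℝ) f q

/-- The form `df - θ`. -/
def exactSubTaut (f : CotangentBundle 𝓘(ℝ, E) N → ℝ) :
    FormField (ModelWithCorners.prod 𝓘(ℝ, E) 𝓘(ℝ, E →L[ℝ] ℝ)) (CotangentBundle 𝓘(ℝ, E) N) 1 :=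
  fun q => ContinuousAlternatingMap.ofSubsingleton ℝ (TangentSpace J q) ℝ (0 : Fin 1)
    (cotangentDifferential f q - tautologicalLinear q)

variable {f : CotangentBundle 𝓘(ℝ, E) N → ℝ}

theorem exactSubTaut_inChart (hf : ContMDiff J 𝓘(ℝ, ℝ) ∞ f) {p : T⋆} {y : E × (E →L[ℝ] ℝ)}
    (hy : y ∈ (extChartAt J p).target) : (exactSubTaut f).inChart p y =
      oneForm (fun y => fderiv ℝ (f ∘ (extChartAt J p).symm) y - dualTaut E y) y := by
  have hd : fderiv ℝ (f ∘ (extChartAt J p).symm) y =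
      (mfderiv J 𝓘(ℝ, ℝ) f ((extChartAt J p).symm y)).comp
        (mfderiv 𝓘(ℝ, E × (E →L[ℝ] ℝ)) J (extChartAt J p).symm y) := by
    rw [← mfderiv_eq_fderiv]
    exact mfderiv_comp y (hf.mdifferentiableAt (by simp)) (mdifferentiableAt_cotangent_symm hy)
  unfold FormField.inChart
  rw [ModelWithCorners.range_eq_univ, mfderivWithin_univ]
  ext v
  rw [oneForm_apply, hd]
  have h := tautologicalLinear_symm hy (v 0)
  exact congrArg (fun t => cotangentDifferential f ((extChartAt J p).symm y)
    (mfderiv 𝓘(ℝ, E × (E →L[ℝ] ℝ)) J (extChartAt J p).symm y (v 0)) - t) h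

theorem contDiffOn_comp_symm (hf : ContMDiff J 𝓘(ℝ, ℝ) ∞ f) (p : T⋆) :
    ContDiffOn ℝ ∞ (f ∘ (extChartAt J p).symm) (extChartAt J p).target :=
  contMDiffOn_iff_contDiffOn.1 (hf.comp_contMDiffOn (contMDiffOn_extChartAt_symm p))

theorem contDiffOn_fderiv_sub_dualTaut (hf : ContMDiff J 𝓘(ℝ, ℝ) ∞ f) (p : T⋆) :
    ContDiffOn ℝ ∞ (fun y => fderiv ℝ (f ∘ (extChartAt J p).symm) y - dualTaut E y)
      (extChartAt J p).target :=
  (contDiffOn_comp_symm hf p).fderiv_sub_clm (isOpen_cotangent_extChartAt_target p) _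

theorem exactSubTaut_isSmooth (hf : ContMDiff J 𝓘(ℝ, ℝ) ∞ f) : (exactSubTaut f).IsSmooth :=
  fun p => (contDiffOn_fderiv_sub_dualTaut hf p).oneForm.congr fun _ hy =>
    exactSubTaut_inChart hf hy

theorem exactSubTaut_d (hf : ContMDiff J 𝓘(ℝ, ℝ) ∞ f) :
    (exactSubTaut f).d = canonicalForm 𝓘(ℝ, E) N := by
  funext p
  rw [canonicalForm_eq]
  unfold FormField.d
  rw [ModelWithCorners.range_eq_univ, extDerivWithin_univ]
  have ht := (isOpen_cotangent_extChartAt_target p).mem_nhds (mem_extChartAt_target (I := J) p)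
  have h : (exactSubTaut f).inChart p =ᶠ[𝓝 (extChartAt J p p)]
      oneForm (fun y => fderiv ℝ (f ∘ (extChartAt J p).symm) y - dualTaut E y) := by
    filter_upwards [ht] with y hy using exactSubTaut_inChart hf hy
  rw [h.extDeriv_eq, extDeriv_oneForm_fderiv_sub ((contDiffOn_comp_symm hf p).contDiffAt ht),
    extDeriv_dualTaut, neg_neg]

theorem exactSubTaut_nowhereVanishing (hf : ∀ q, ¬ DerivEqTaut f q) :
    (exactSubTaut f).NowhereVanishing := by
  intro q hq
  refine hf q fun v => ?_
  have h := congrArg (fun η => η fun _ => v) hq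
  change cotangentDifferential f q v - tautologicalLinear q v = 0 at h
  exact sub_eq_zero.1 h

end CotangentForms

/-! ### The symplectic dual of `df - θ` -/

section LiouvilleField

open Filter Topology Set

variable {E : Type*} [NormedAddCommGroup E] [NormedSpace ℝ E]
  {N : Type*} [TopologicalSpace N] [ChartedSpace E N] [IsManifold 𝓘(ℝ, E) ∞ N]

local notation "J" => ModelWithCorners.prod 𝓘(ℝ, E) 𝓘(ℝ, E →L[ℝ] ℝ)

local notation "T⋆" => CotangentBundle 𝓘(ℝ, E) N

/-- The differential at `q` of the chart of `T*N` around `p`, with values in the model space. -/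
def cotangentChartDeriv (p q : T⋆) : TangentSpace J q →L[ℝ] E × (E →L[ℝ] ℝ) :=
  mfderiv J 𝓘(ℝ, E × (E →L[ℝ] ℝ)) (extChartAt J p) q

theorem cotangentChartDeriv_symm {p : T⋆} {y : E × (E →L[ℝ] ℝ)}
    (hy : y ∈ (extChartAt J p).target) (k : E × (E →L[ℝ] ℝ)) :
    cotangentChartDeriv p ((extChartAt J p).symm y)
      (mfderiv 𝓘(ℝ, E × (E →L[ℝ] ℝ)) J (extChartAt J p).symm y k) = k := by
  have h := mfderiv_extChartAt_comp_mfderivWithin_extChartAt_symm (I := J) hy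
  rw [ModelWithCorners.range_eq_univ, mfderivWithin_univ] at h
  exact congrArg (fun L => L k) h

theorem isInvertible_cotangentChartDeriv {p q : T⋆} (hq : q ∈ (extChartAt J p).source) :
    (cotangentChartDeriv p q).IsInvertible :=
  isInvertible_mfderiv_extChartAt (I := J) hq

theorem canonicalForm_apply {p q : T⋆} (hq : q ∈ (extChartAt J p).source)
    (v : Fin 2 → TangentSpace J q) : canonicalForm 𝓘(ℝ, E) N q v =
      dualSymplectic E fun i => cotangentChartDeriv p q (v i) := by
  obtain ⟨y, hy, rfl⟩ : ∃ y ∈ (extChartAt J p).target, (extChartAt J p).symm y = q :=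
    ⟨_, (extChartAt J p).map_source hq, (extChartAt J p).left_inv hq⟩
  have hex : ∀ i, ∃ w : E × (E →L[ℝ] ℝ),
      mfderiv 𝓘(ℝ, E × (E →L[ℝ] ℝ)) J (extChartAt J p).symm y w = v i :=
    fun i => surjective_mfderiv_cotangent_symm hy (v i)
  choose w hw using hex
  have h1 : (fun i => cotangentChartDeriv p ((extChartAt J p).symm y) (v i)) = w :=
    funext fun i => by rw [← hw i, cotangentChartDeriv_symm hy]
  have h2 := congrArg (fun η => η w) (canonicalForm_inChart hy)
  unfold FormField.inChart at h2
  rw [ModelWithCorners.range_eq_univ, mfderivWithin_univ] at h2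
  rw [h1, ← h2, ← funext hw]
  rfl

variable (f : CotangentBundle 𝓘(ℝ, E) N → ℝ)

/-- The expression of `df - θ` in the canonical coordinates around `p`. -/
def exactSubTautLocal (p : T⋆) (y : E × (E →L[ℝ] ℝ)) : E × (E →L[ℝ] ℝ) →L[ℝ] ℝ :=
  fderiv ℝ (f ∘ (extChartAt J p).symm) y - dualTaut E y

/-- The vector field corresponding to `df - θ` under the inverse `S` of the symplectic form. -/
def liouvilleField (S : (E × (E →L[ℝ] ℝ) →L[ℝ] ℝ) →L[ℝ] E × (E →L[ℝ] ℝ)) (q : T⋆) :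
    TangentSpace J q :=
  (cotangentChartDeriv q q).inverse (S (exactSubTautLocal f q (extChartAt J q q)))

variable {f}

theorem exactSubTautLocal_apply (hf : ContMDiff J 𝓘(ℝ, ℝ) ∞ f) {p q : T⋆}
    (hq : q ∈ (extChartAt J p).source) (v : TangentSpace J q) :
    exactSubTautLocal f p (extChartAt J p q) (cotangentChartDeriv p q v) =
      exactSubTaut f q fun _ => v := by
  obtain ⟨y, hy, rfl⟩ : ∃ y ∈ (extChartAt J p).target, (extChartAt J p).symm y = q :=
    ⟨_, (extChartAt J p).map_source hq, (extChartAt J p).left_inv hq⟩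
  obtain ⟨w, rfl⟩ : ∃ w : E × (E →L[ℝ] ℝ),
      mfderiv 𝓘(ℝ, E × (E →L[ℝ] ℝ)) J (extChartAt J p).symm y w = v :=
    surjective_mfderiv_cotangent_symm hy v
  rw [(extChartAt J p).right_inv hy, cotangentChartDeriv_symm hy]
  have h := congrArg (fun η => η fun _ => w) (exactSubTaut_inChart hf hy)
  unfold FormField.inChart at h
  rw [ModelWithCorners.range_eq_univ, mfderivWithin_univ] at h
  exact h.symm

variable {S : (E × (E →L[ℝ] ℝ) →L[ℝ] ℝ) →L[ℝ] E × (E →L[ℝ] ℝ)}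

/-- This is `ι_X ω_can = df - θ`, a description of the field free of charts. -/
theorem canonicalForm_liouvilleField (hS : ∀ l k, dualSymplectic E ![S l, k] = l k)
    (hf : ContMDiff J 𝓘(ℝ, ℝ) ∞ f) (q : T⋆) (v : TangentSpace J q) :
    canonicalForm 𝓘(ℝ, E) N q ![liouvilleField f S q, v] = exactSubTaut f q fun _ => v := by
  have hq := mem_extChartAt_source (I := J) q
  rw [canonicalForm_apply hq, ← exactSubTautLocal_apply hf hq, ← hS]
  congr 1
  funext i
  fin_cases i
  · exact (isInvertible_cotangentChartDeriv hq).self_apply_inverse _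
  · rfl

theorem liouvilleField_ne_zero (hS : ∀ l k, dualSymplectic E ![S l, k] = l k)
    (hf : ContMDiff J 𝓘(ℝ, ℝ) ∞ f) {q : T⋆} (hq : exactSubTaut f q ≠ 0) :
    liouvilleField f S q ≠ 0 := by
  intro h0
  refine hq (ContinuousAlternatingMap.ext fun v => ?_)
  have h := canonicalForm_liouvilleField hS hf q (v 0)
  rw [h0] at h
  rw [show v = fun _ => v 0 from funext fun i => by rw [Subsingleton.elim i 0], ← h]
  exact (canonicalForm 𝓘(ℝ, E) N q).map_coord_zero (0 : Fin 2) rfl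

/-- The field is defined at `q` by the chart around `q`. Nondegeneracy makes the contraction
identity determine it, so a fixed chart around `p` gives the same formula; smoothness follows from
this. -/
theorem cotangentChartDeriv_liouvilleField (hS : ∀ l k, dualSymplectic E ![S l, k] = l k)
    (hS' : ∀ l h, (∀ k, dualSymplectic E ![h, k] = l k) → h = S l)
    (hf : ContMDiff J 𝓘(ℝ, ℝ) ∞ f) {p q : T⋆} (hq : q ∈ (extChartAt J p).source) :
    cotangentChartDeriv p q (liouvilleField f S q) =
      S (exactSubTautLocal f p (extChartAt J p q)) := by
  refine hS' _ _ fun k => ?_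
  obtain ⟨v, rfl⟩ := (isInvertible_cotangentChartDeriv hq).bijective.surjective k
  rw [exactSubTautLocal_apply hf hq, ← canonicalForm_liouvilleField hS hf, canonicalForm_apply hq]
  congr 1
  funext i
  fin_cases i <;> rfl

theorem mpullbackWithin_liouvilleField (hS : ∀ l k, dualSymplectic E ![S l, k] = l k)
    (hS' : ∀ l h, (∀ k, dualSymplectic E ![h, k] = l k) → h = S l)
    (hf : ContMDiff J 𝓘(ℝ, ℝ) ∞ f) {p : T⋆} {y : E × (E →L[ℝ] ℝ)}
    (hy : y ∈ (extChartAt J p).target) :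
    VectorField.mpullbackWithin 𝓘(ℝ, E × (E →L[ℝ] ℝ)) J (extChartAt J p).symm
      (liouvilleField f S) (range J) y = S (exactSubTautLocal f p y) := by
  have h1 := cotangentChartDeriv_liouvilleField hS hS' hf ((extChartAt J p).map_target hy)
  rw [(extChartAt J p).right_inv hy] at h1
  rw [VectorField.mpullbackWithin_apply, ← h1, ContinuousLinearMap.inverse_eq
    (mfderivWithin_extChartAt_symm_comp_mfderiv_extChartAt hy)
    (mfderiv_extChartAt_comp_mfderivWithin_extChartAt_symm hy)]
  rfl

theorem contDiffOn_sharp_exactSubTautLocal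
    (S : (E × (E →L[ℝ] ℝ) →L[ℝ] ℝ) →L[ℝ] E × (E →L[ℝ] ℝ))
    (hf : ContMDiff J 𝓘(ℝ, ℝ) ∞ f) (p : T⋆) :
    ContDiffOn ℝ ∞ (fun y => S (exactSubTautLocal f p y)) (extChartAt J p).target :=
  (contDiffOn_fderiv_sub_dualTaut hf p).comp_sharp S

theorem contMDiff_liouvilleField (hS : ∀ l k, dualSymplectic E ![S l, k] = l k)
    (hS' : ∀ l h, (∀ k, dualSymplectic E ![h, k] = l k) → h = S l)
    (hf : ContMDiff J 𝓘(ℝ, ℝ) ∞ f) :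
    ContMDiff J (ModelWithCorners.tangent J) ∞
      (fun q : T⋆ => (⟨q, liouvilleField f S q⟩ : TangentBundle J T⋆)) := by
  intro p
  refine (Bundle.contMDiffAt_section p).2 ?_
  have hs := (isOpen_extChartAt_source (I := J) p).mem_nhds (mem_extChartAt_source p)
  have h : ContMDiffAt J 𝓘(ℝ, E × (E →L[ℝ] ℝ)) ∞
      ((fun y => S (exactSubTautLocal f p y)) ∘ extChartAt J p) p :=
    ((contDiffOn_sharp_exactSubTautLocal S hf p).contMDiffOn.contMDiffAt
      ((isOpen_cotangent_extChartAt_target p).mem_nhds (mem_extChartAt_target p))).comp p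
      contMDiffAt_extChartAt
  refine h.congr_of_eventuallyEq ?_
  filter_upwards [hs] with q hq
  have hq' : q ∈ (chartAt (ModelProd E (E →L[ℝ] ℝ)) p).source := by
    rwa [extChartAt_source] at hq
  have h1 := cotangentChartDeriv_liouvilleField hS hS' hf hq
  have h2 := congrArg (fun L => L (liouvilleField f S q))
    (TangentBundle.continuousLinearMapAt_trivializationAt (I := J) hq')
  refine Eq.trans ?_ (h2.trans h1)
  rw [Bundle.Trivialization.continuousLinearMapAt_apply,
    Bundle.Trivialization.linearMapAt_apply, if_pos (by simpa using hq')]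

/-- In a chart `ω_can` is constant, so the derivative term of the Lie derivative vanishes. The
remaining sum is the exterior derivative of the local expression of `df - θ`, which is `ω_can`. -/
theorem isLiouvilleField_liouvilleField (hS : ∀ l k, dualSymplectic E ![S l, k] = l k)
    (hS' : ∀ l h, (∀ k, dualSymplectic E ![h, k] = l k) → h = S l)
    (hf : ContMDiff J 𝓘(ℝ, ℝ) ∞ f) :
    IsLiouvilleField (canonicalForm 𝓘(ℝ, E) N) (liouvilleField f S) where
  smooth := contMDiff_liouvilleField hS hS' hf
  lieDeriv_eq p v := by
    have ht := (isOpen_cotangent_extChartAt_target p).mem_nhds (mem_extChartAt_target (I := J) p)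
    have h1 : (canonicalForm 𝓘(ℝ, E) N).inChart p =ᶠ[𝓝 (extChartAt J p p)]
        fun _ => dualSymplectic E := by
      filter_upwards [ht] with y hy using canonicalForm_inChart hy
    have h2 : VectorField.mpullbackWithin 𝓘(ℝ, E × (E →L[ℝ] ℝ)) J (extChartAt J p).symm
        (liouvilleField f S) (range J) =ᶠ[𝓝 (extChartAt J p p)]
          fun y => S (exactSubTautLocal f p y) := by
      filter_upwards [ht] with y hy using mpullbackWithin_liouvilleField hS hS' hf hy
    have hB : DifferentiableAt ℝ (exactSubTautLocal f p) (extChartAt J p p) :=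
      ((contDiffOn_fderiv_sub_dualTaut hf p).contDiffAt ht).differentiableAt (by simp)
    have h3 := sum_update_fderiv_sharp hS hB fun i => cotangentChartDeriv p p (v i)
    have h4 : extDeriv (oneForm (exactSubTautLocal f p)) (extChartAt J p p) = dualSymplectic E := by
      refine (extDeriv_oneForm_fderiv_sub ((contDiffOn_comp_symm hf p).contDiffAt ht) _).trans ?_
      rw [extDeriv_dualTaut, neg_neg]
    rw [h4, ← canonicalForm_apply (mem_extChartAt_source p)] at h3
    refine Eq.trans ?_ h3
    let X' : E × (E →L[ℝ] ℝ) → E × (E →L[ℝ] ℝ) := VectorField.mpullbackWithin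
      𝓘(ℝ, E × (E →L[ℝ] ℝ)) J (extChartAt J p).symm (liouvilleField f S) (range J)
    have h5 : fderivWithin ℝ X' (range J) (extChartAt J p p) =
        fderiv ℝ (fun y => S (exactSubTautLocal f p y)) (extChartAt J p p) := by
      rw [ModelWithCorners.range_eq_univ, fderivWithin_univ]
      exact h2.fderiv_eq
    have h6 : fderivWithin ℝ ((canonicalForm 𝓘(ℝ, E) N).inChart p) (range J)
        (extChartAt J p p) = 0 := by
      rw [ModelWithCorners.range_eq_univ, fderivWithin_univ, h1.fderiv_eq, fderiv_fun_const]
      rfl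
    let v' : Fin 2 → E × (E →L[ℝ] ℝ) := fun i => cotangentChartDeriv p p (v i)
    change fderivWithin ℝ ((canonicalForm 𝓘(ℝ, E) N).inChart p) (range J) (extChartAt J p p)
      (X' (extChartAt J p p)) v' + ∑ i, (canonicalForm 𝓘(ℝ, E) N).inChart p (extChartAt J p p)
        (Function.update v' i (fderivWithin ℝ X' (range J) (extChartAt J p p) (v' i))) = _
    rw [h5, h6, h1.eq_of_nhds]
    exact zero_add _

end LiouvilleField

theorem corollary1p3 (n : ℕ) (hn : 1 ≤ n) (N : Type*) [TopologicalSpace N] [T2Space N]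
    [SecondCountableTopology N] [ChartedSpace (EuclideanSpace ℝ (Fin n)) N]
    [IsManifold (𝓡 n) ∞ N] :
    (∃ α : FormField ((𝓡 n).prod 𝓘(ℝ, EuclideanSpace ℝ (Fin n) →L[ℝ] ℝ))
        (CotangentBundle (𝓡 n) N) 1,
      α.IsSmooth ∧ α.NowhereVanishing ∧ α.d = canonicalForm (𝓡 n) N) ∧
    (∃ X : ∀ ξ : CotangentBundle (𝓡 n) N,
        TangentSpace ((𝓡 n).prod 𝓘(ℝ, EuclideanSpace ℝ (Fin n) →L[ℝ] ℝ)) ξ,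
      IsLiouvilleField (canonicalForm (𝓡 n) N) X ∧ ∀ ξ, X ξ ≠ 0) := by
  -- Positive dimension makes the model space nontrivial, which provides the unit covector along
  -- which coincidences are swept away.
  have : Nonempty (Fin n) := ⟨⟨0, hn⟩⟩
  obtain ⟨f, hf, hne⟩ := exists_forall_not_derivEqTaut (E := EuclideanSpace ℝ (Fin n)) (N := N)
  obtain ⟨S, hS, hS'⟩ := exists_dualSymplectic_sharp (E := EuclideanSpace ℝ (Fin n))
  have hα := exactSubTaut_nowhereVanishing hne
  exact ⟨⟨exactSubTaut f, exactSubTaut_isSmooth hf, hα, exactSubTaut_d hf⟩,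
    liouvilleField f S, isLiouvilleField_liouvilleField hS hS' hf,
    fun q => liouvilleField_ne_zero hS hf (hα q)⟩

end
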